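/- Let $p$ be an odd prime and let $b$ be a generator of the cyclic group $\mathrm{C}_{4p}$ of order $4p$. A skew morphism of a finite group $B$ is a permutation $\varphi$ of $B$ with $\varphi(1)=1$ such that for every $a\in B$ there is a positive integer $i_a$ with $\varphi(ac)=\varphi(a)\varphi^{i_a}(c)$ for all $c\in B$; it is called proper if it is not a group automorphism of $B$. Define the following permutations of $\mathrm{C}_{4p}$, where $t$ ranges over all integers. (x) For $s=4i+2$ with $i\in\{0,\dots,p-1\}$, $i\neq (p-1)/2$: $x_s(b^{2t+1})=b^{2t+1+s}$ and $x_s(b^{2t})=b^{2t}$. (y) For $s=4i$ with $i\in\{1,\dots,p-1\}$: $y_s(b^{2t+1})=b^{2t+1+s}$ and $y_s(b^{2t})=b^{2t}$. (z) If $p\equiv 1\pmod 4$, for every integer $\omega$ with $\omega^2\equiv -1\pmod p$ and every $s=4i$ with $i\in\{1,\dots,p-1\}$: $z_{\omega,s}(b^{4t+1})=b^{4t+1+s}$, $z_{\omega,s}(b^{4t+2})=b^{4t+2+s(\omega+1)}$, $z_{\omega,s}(b^{4t+3})=b^{4t+3+s\omega}$ and $z_{\omega,s}(b^{4t})=b^{4t}$.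 Then the proper skew morphisms of $\mathrm{C}_{4p}$ are exactly the permutations $x_s$ and $y_s$ and, if $p\equiv 1\pmod 4$, also the permutations $z_{\omega,s}$. Consequently, the skew morphisms of $\mathrm{C}_{4p}$ are exactly its group automorphisms together with these permutations. -/

import Mathlib

namespace SkewC4p

/-- A skew morphism of a group `G`: a permutation `φ` of `G` that fixes the identity and such that
for every `a` there is a positive integer `i` with `φ (a * c) = φ a * φ ^ i (c)` for all `c`. -/
def IsSkewMorphism {G : Type*} [Group G] (φ : Equiv.Perm G) : Prop :=
  φ 1 = 1 ∧ ∀ a : G, ∃ i : ℕ, 0 < i ∧ ∀ c : G, φ (a * c) = φ a * (φ ^ i) c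

/-- The permutation `φ` is a group automorphism of `G`. -/
def IsAutomorphism {G : Type*} [Group G] (φ : Equiv.Perm G) : Prop :=
  ∃ α : G ≃* G, φ = α.toEquiv

/-- A proper skew morphism is a skew morphism that is not a group automorphism. -/
def IsProperSkewMorphism {G : Type*} [Group G] (φ : Equiv.Perm G) : Prop :=
  IsSkewMorphism φ ∧ ¬ IsAutomorphism φ

/-- If `d` takes values in the subgroup `K` and is constant on the left cosets of `K`, then
`g ↦ g * d g` is a permutation. -/
def cosetShift {G : Type*} [Group G] (K : Subgroup G) (d : G → G) (hK : ∀ g, d g ∈ K)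
    (hd : ∀ g, ∀ k ∈ K, d (g * k) = d g) : Equiv.Perm G where
  toFun g := g * d g
  invFun g := g * (d g)⁻¹
  left_inv g := by simp [hd g _ (hK g)]
  right_inv g := by simp [hd g _ (K.inv_mem (hK g))]

open Classical in
/-- The permutation with `b ^ (2 * t + 1) ↦ b ^ (2 * t + 1 + s)` and `b ^ (2 * t) ↦ b ^ (2 * t)`,
for even `s`: it fixes `⟨b ^ 2⟩` pointwise and multiplies all other elements by `b ^ s`. -/
noncomputable def oddShift {G : Type*} [Group G] (b : G) (s : ℤ) (hs : (2 : ℤ) ∣ s) :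
    Equiv.Perm G :=
  cosetShift (Subgroup.zpowers (b ^ (2 : ℤ)))
    (fun g => if g ∈ Subgroup.zpowers (b ^ (2 : ℤ)) then 1 else b ^ s)
    (fun g => by
      split_ifs
      · exact Subgroup.one_mem _
      · obtain ⟨r, rfl⟩ := hs
        exact ⟨r, by simp [zpow_mul]⟩)
    (fun g k hk => by simp only [Subgroup.mul_mem_cancel_right _ hk])

/-- The permutation `x_s`, `s = 4 * i + 2`. -/
noncomputable def xPerm {G : Type*} [Group G] (b : G) (i : ℤ) : Equiv.Perm G :=
  oddShift b (4 * i + 2) (by omega)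

/-- The permutation `y_s`, `s = 4 * i`. -/
noncomputable def yPerm {G : Type*} [Group G] (b : G) (i : ℤ) : Equiv.Perm G :=
  oddShift b (4 * i) (by omega)

open Classical in
/-- The permutation `z_{ω,s}`, `s = 4 * i`: it fixes `⟨b ^ 4⟩` pointwise and multiplies the
elements of the cosets `b⟨b ^ 4⟩`, `b ^ 2⟨b ^ 4⟩`, `b ^ 3⟨b ^ 4⟩` by `b ^ s`, `b ^ (s * (ω + 1))`
and `b ^ (s * ω)` respectively. -/
noncomputable def zPerm {G : Type*} [Group G] (b : G) (ω i : ℤ) : Equiv.Perm G :=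
  cosetShift (Subgroup.zpowers (b ^ (4 : ℤ)))
    (fun g =>
      if b ^ (-1 : ℤ) * g ∈ Subgroup.zpowers (b ^ (4 : ℤ)) then b ^ (4 * i)
      else if b ^ (-2 : ℤ) * g ∈ Subgroup.zpowers (b ^ (4 : ℤ)) then b ^ (4 * i * (ω + 1))
      else if b ^ (-3 : ℤ) * g ∈ Subgroup.zpowers (b ^ (4 : ℤ)) then b ^ (4 * i * ω)
      else 1)
    (fun g => by
      split_ifs
      · exact ⟨i, by simp [zpow_mul]⟩
      · exact ⟨i * (ω + 1), by simp [zpow_mul]⟩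
      · exact ⟨i * ω, by simp [zpow_mul]⟩
      · exact Subgroup.one_mem _)
    (fun g k hk => by simp only [← mul_assoc, Subgroup.mul_mem_cancel_right _ hk])

/-! The defining formulas of the three families, for `b` a generator of a group of order `4 * p`. -/

theorem zpow_mem_zpowers_zpow {G : Type*} [Group G] {b : G} {m : ℤ} (hm : m ∣ orderOf b)
    (k : ℤ) : b ^ k ∈ Subgroup.zpowers (b ^ m) ↔ m ∣ k := by
  constructor
  · rintro ⟨r, hr⟩
    have h : b ^ (m * r) = b ^ k := by simpa [zpow_mul] using hr
    have h2 : (orderOf b : ℤ) ∣ k - m * r := by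
      rw [orderOf_dvd_iff_zpow_eq_one, zpow_sub, h, mul_inv_cancel]
    have h3 := dvd_add (hm.trans h2) (dvd_mul_right m r)
    simpa using h3
  · rintro ⟨r, rfl⟩
    exact ⟨r, by simp [zpow_mul]⟩

theorem four_dvd_orderOf {G : Type*} [Group G] {p : ℕ} {b : G}
    (hG : Nat.card G = 4 * p) (hb : ∀ g : G, g ∈ Subgroup.zpowers b) :
    (4 : ℤ) ∣ orderOf b := by
  rw [orderOf_eq_card_of_forall_mem_zpowers hb, hG]
  push_cast
  exact dvd_mul_right _ _

theorem xPerm_apply {G : Type*} [Group G] {p : ℕ} {b : G}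
    (hG : Nat.card G = 4 * p) (hb : ∀ g : G, g ∈ Subgroup.zpowers b) (i t : ℤ) :
    xPerm b i (b ^ (2 * t + 1)) = b ^ (2 * t + 1 + (4 * i + 2)) ∧
      xPerm b i (b ^ (2 * t)) = b ^ (2 * t) := by
  have h2 : (2 : ℤ) ∣ orderOf b := dvd_trans (by norm_num) (four_dvd_orderOf hG hb)
  have h := zpow_mem_zpowers_zpow h2
  constructor
  · simp only [xPerm, oddShift, cosetShift, Equiv.coe_fn_mk, h]
    rw [if_neg (by omega), ← zpow_add]
  · simp only [xPerm, oddShift, cosetShift, Equiv.coe_fn_mk, h]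
    rw [if_pos (by omega), mul_one]

theorem yPerm_apply {G : Type*} [Group G] {p : ℕ} {b : G}
    (hG : Nat.card G = 4 * p) (hb : ∀ g : G, g ∈ Subgroup.zpowers b) (i t : ℤ) :
    yPerm b i (b ^ (2 * t + 1)) = b ^ (2 * t + 1 + 4 * i) ∧
      yPerm b i (b ^ (2 * t)) = b ^ (2 * t) := by
  have h2 : (2 : ℤ) ∣ orderOf b := dvd_trans (by norm_num) (four_dvd_orderOf hG hb)
  have h := zpow_mem_zpowers_zpow h2
  constructor
  · simp only [yPerm, oddShift, cosetShift, Equiv.coe_fn_mk, h]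
    rw [if_neg (by omega), ← zpow_add]
  · simp only [yPerm, oddShift, cosetShift, Equiv.coe_fn_mk, h]
    rw [if_pos (by omega), mul_one]

theorem zPerm_apply {G : Type*} [Group G] {p : ℕ} {b : G}
    (hG : Nat.card G = 4 * p) (hb : ∀ g : G, g ∈ Subgroup.zpowers b) (ω i t : ℤ) :
    zPerm b ω i (b ^ (4 * t + 1)) = b ^ (4 * t + 1 + 4 * i) ∧
      zPerm b ω i (b ^ (4 * t + 2)) = b ^ (4 * t + 2 + 4 * i * (ω + 1)) ∧
      zPerm b ω i (b ^ (4 * t + 3)) = b ^ (4 * t + 3 + 4 * i * ω) ∧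
      zPerm b ω i (b ^ (4 * t)) = b ^ (4 * t) := by
  have h := zpow_mem_zpowers_zpow (four_dvd_orderOf hG hb)
  refine ⟨?_, ?_, ?_, ?_⟩ <;>
    simp only [zPerm, cosetShift, Equiv.coe_fn_mk, ← zpow_add, h]
  · rw [if_pos (by omega), ← zpow_add]
  · rw [if_neg (by omega), if_pos (by omega), ← zpow_add]
  · rw [if_neg (by omega), if_neg (by omega), if_pos (by omega), ← zpow_add]
  · rw [if_neg (by omega), if_neg (by omega), if_neg (by omega), mul_one]

/-- `φ` is one of the `x_s`: `s = 4 * i + 2`, `i ∈ {0, …, p - 1}`, `i ≠ (p - 1) / 2`. -/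
def IsX {G : Type*} [Group G] (p : ℕ) (b : G) (φ : Equiv.Perm G) : Prop :=
  ∃ i : ℕ, i ≤ p - 1 ∧ i ≠ (p - 1) / 2 ∧ φ = xPerm b i

/-- `φ` is one of the `y_s`: `s = 4 * i`, `i ∈ {1, …, p - 1}`. -/
def IsY {G : Type*} [Group G] (p : ℕ) (b : G) (φ : Equiv.Perm G) : Prop :=
  ∃ i : ℕ, 1 ≤ i ∧ i ≤ p - 1 ∧ φ = yPerm b i

/-- `φ` is one of the `z_{ω,s}`: `ω ^ 2 ≡ -1` modulo `p`, `s = 4 * i`, `i ∈ {1, …, p - 1}`. -/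
def IsZ {G : Type*} [Group G] (p : ℕ) (b : G) (φ : Equiv.Perm G) : Prop :=
  ∃ (ω : ℤ) (i : ℕ), ω ^ 2 ≡ -1 [ZMOD p] ∧ 1 ≤ i ∧ i ≤ p - 1 ∧ φ = zPerm b ω i

end SkewC4p

/-!
Let `G` be cyclic of order `4 * p` with generator `b`, let `φ` be a skew morphism and `K` its
kernel, the subgroup of all `a` with `φ (a * c) = φ a * φ c` for every `c`.

The fixed points of a power of `φ` form a subgroup (`fixedSubgroup`), so the order of `φ` is the
length of the orbit of `b` and is less than the order of `G`. Elements with the same exponent lie in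
the same coset of `K`, hence `K` has fewer cosets than `φ` has powers
(`card_quotient_skewKernel_lt_orderOf`), and `K` is nontrivial. As `G` has one subgroup of each
order, `φ` maps `K` to itself and induces a skew morphism of `G ⧸ K` (`quotientPerm`), which allows
induction on the order.

When the quotient is an automorphism, take the least `N` such that `φ ^ N` is trivial on `K` and on
`G ⧸ K` (`exists_translation_power`). Then `φ ^ N` multiplies `c` by some `g c` in `K` depending on
the coset of `c` only, with `g (b ^ n) = g b ^ (1 + κ + ⋯ + κ ^ (n - 1))`, all exponents of `φ` are
`1` modulo `N`, and `φ` is an automorphism if `g b = 1`. In particular the index of `K` is at most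
its order. These counts, and for `K` of order `4` the parity of the geometric sum, leave only
kernels of order `p` and `2 * p` when `φ` is proper (`card_skewKernel_eq`).

For `K` of order `2 * p` one congruence modulo `p` forces `φ` to be an automorphism or a shift of
the odd powers of `b` (`exists_eq_oddShift`). For `K` of order `p` a fixed point argument shows
`N = 1` or `N = 2`; the second case is excluded by the symmetry of `φ (a * c)` in `a` and `c`
(`exists_translation_of_card_skewKernel_prime`). If `N = 1`, then `g (b ^ 4) = 1` means
`(1 + κ) * (1 + κ ^ 2) ≡ 0` modulo `p`, and the two factors give `y_s` and `z_{κ,s}`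
(`isY_or_isZ`). That the listed permutations are proper skew morphisms is a direct computation
with explicit exponents.
-/

namespace SkewC4p

/-! ### Powers of a skew morphism and their fixed points -/

section Group

variable {G : Type*} [Group G] {φ : Equiv.Perm G}

theorem isAutomorphism_iff : IsAutomorphism φ ↔ ∀ a c, φ (a * c) = φ a * φ c := by
  constructor
  · rintro ⟨α, rfl⟩ a c
    exact map_mul α a c
  · intro h
    exact ⟨MulEquiv.mk φ h, rfl⟩

theorem IsAutomorphism.isSkewMorphism (h : IsAutomorphism φ) : IsSkewMorphism φ := by
  obtain ⟨α, rfl⟩ := h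
  exact ⟨map_one α, fun a => ⟨1, one_pos, fun c => map_mul α a c⟩⟩

theorem IsSkewMorphism.pow_apply_one (h : IsSkewMorphism φ) (k : ℕ) : (φ ^ k) 1 = 1 := by
  induction k with
  | zero => rfl
  | succ k ih => rw [pow_succ', Equiv.Perm.mul_apply, ih, h.1]

theorem IsSkewMorphism.pow_apply_mul (h : IsSkewMorphism φ) (k : ℕ) (a : G) :
    ∃ i : ℕ, ∀ c, (φ ^ k) (a * c) = (φ ^ k) a * (φ ^ i) c := by
  induction k with
  | zero => exact ⟨0, fun c => rfl⟩
  | succ k ih =>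
    obtain ⟨i, hi⟩ := ih
    obtain ⟨j, -, hj⟩ := h.2 ((φ ^ k) a)
    refine ⟨j + i, fun c => ?_⟩
    rw [pow_succ', Equiv.Perm.mul_apply, hi, hj, Equiv.Perm.mul_apply, pow_add,
      Equiv.Perm.mul_apply]

theorem pow_apply_eq_self_iff {α : Type*} (f : Equiv.Perm α) (k : ℕ) (c : α) :
    (f ^ k) c = c ↔ Function.minimalPeriod f c ∣ k := by
  rw [← Function.isPeriodicPt_iff_minimalPeriod_dvd, Equiv.Perm.coe_pow]
  rfl

/-- In a cyclic group powers of the same order generate the same subgroup, so they have the same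
fixed points. -/
theorem pow_apply_eq_self_of_orderOf_eq {α : Type*} [Finite α] {f : Equiv.Perm α} {k i : ℕ}
    (h : orderOf (f ^ k) = orderOf (f ^ i)) {c : α} (hc : (f ^ k) c = c) : (f ^ i) c = c := by
  rw [pow_apply_eq_self_iff] at hc ⊢
  have h1 : Function.minimalPeriod f c ∣ orderOf f := by
    rw [← pow_apply_eq_self_iff, pow_orderOf_eq_one]; rfl
  have h2 := Nat.dvd_gcd h1 hc
  have h0 := orderOf_pos f
  have h3 : (orderOf f).gcd k = (orderOf f).gcd i := by
    rw [orderOf_pow, orderOf_pow] at h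
    have e1 := Nat.div_mul_cancel (Nat.gcd_dvd_left (orderOf f) k)
    have e2 := Nat.div_mul_cancel (Nat.gcd_dvd_left (orderOf f) i)
    rw [h] at e1
    have h4 : 0 < orderOf f / (orderOf f).gcd i :=
      Nat.div_pos (Nat.le_of_dvd h0 (Nat.gcd_dvd_left _ _)) (Nat.gcd_pos_of_pos_left _ h0)
    exact Nat.eq_of_mul_eq_mul_left h4 (e1.trans e2.symm)
  rw [h3] at h2
  exact h2.trans (Nat.gcd_dvd_right _ _)

/-- The fixed points of a power of a skew morphism are closed under multiplication: if
`ψ = φ ^ k` fixes `a`, then left translation by `a` conjugates `ψ` into a power `φ ^ i` of the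
same order, which therefore has the same fixed points as `ψ`. -/
theorem IsSkewMorphism.pow_fixed_mul [Finite G] (h : IsSkewMorphism φ) {k : ℕ} {a c : G}
    (ha : (φ ^ k) a = a) (hc : (φ ^ k) c = c) : (φ ^ k) (a * c) = a * c := by
  obtain ⟨i, hi⟩ := h.pow_apply_mul k a
  have hconj : φ ^ i = MulAut.conj (Equiv.mulLeft a)⁻¹ (φ ^ k) := by
    ext c
    simp [MulAut.conj_apply, hi, ha]
  have ho : orderOf (φ ^ k) = orderOf (φ ^ i) := by
    rw [hconj]
    exact (MulEquiv.orderOf_eq _ _).symm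
  rw [hi, ha, pow_apply_eq_self_of_orderOf_eq ho hc]

/-- The subgroup of fixed points of a power of a skew morphism. -/
def fixedSubgroup [Finite G] (h : IsSkewMorphism φ) (k : ℕ) : Subgroup G where
  carrier := {a | (φ ^ k) a = a}
  one_mem' := h.pow_apply_one k
  mul_mem' := h.pow_fixed_mul
  inv_mem' {a} ha := by
    obtain ⟨n, hn⟩ : ∃ n : ℕ, a ^ n = a⁻¹ :=
      ⟨orderOf a - 1, by
        rw [eq_inv_iff_mul_eq_one, ← pow_succ, Nat.sub_add_cancel (orderOf_pos a),
          pow_orderOf_eq_one]⟩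
    rw [← hn]
    clear hn
    induction n with
    | zero => simpa using h.pow_apply_one k
    | succ n ih => rw [pow_succ]; exact h.pow_fixed_mul ih ha

theorem IsSkewMorphism.pow_eq_one_of_apply_eq [Finite G] (h : IsSkewMorphism φ) {b : G}
    (hb : ∀ g : G, g ∈ Subgroup.zpowers b) {k : ℕ} (hk : (φ ^ k) b = b) : φ ^ k = 1 := by
  ext c
  have hb' : b ∈ fixedSubgroup h k := hk
  exact (Subgroup.zpowers_le.2 hb') (hb c)

/-- The order of a power of a skew morphism of a cyclic group is the length of the orbit of a
generator. -/
theorem IsSkewMorphism.orderOf_pow_le [Finite G] (h : IsSkewMorphism φ) {b : G}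
    (hb : ∀ g : G, g ∈ Subgroup.zpowers b) (N : ℕ) {S : Set G}
    (hS : ∀ j, ((φ ^ N) ^ j) b ∈ S) : orderOf (φ ^ N) ≤ Nat.card S := by
  have key : Function.Injective
      (fun j : Fin (orderOf (φ ^ N)) => (⟨((φ ^ N) ^ (j : ℕ)) b, hS j⟩ : S)) := by
    have main : ∀ i j : Fin (orderOf (φ ^ N)), (i : ℕ) ≤ j →
        ((φ ^ N) ^ (i : ℕ)) b = ((φ ^ N) ^ (j : ℕ)) b → i = j := by
      intro i j hij he
      have h1 : (φ ^ (N * ((j : ℕ) - i))) b = b := by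
        apply ((φ ^ N) ^ (i : ℕ)).injective
        rw [← Equiv.Perm.mul_apply, pow_mul, ← pow_add, Nat.add_sub_cancel' hij, he]
      have h2 := h.pow_eq_one_of_apply_eq hb h1
      rw [pow_mul] at h2
      have h3 := Nat.eq_zero_of_dvd_of_lt (orderOf_dvd_of_pow_eq_one h2)
        (lt_of_le_of_lt (Nat.sub_le _ _) j.2)
      exact Fin.ext (by omega)
    intro i j he
    have he' := congrArg Subtype.val he
    rcases le_total (i : ℕ) j with hij | hij
    · exact main i j hij he'
    · exact (main j i hij he'.symm).symm
  simpa using Nat.card_le_card_of_injective _ key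

theorem IsSkewMorphism.orderOf_lt_card [Finite G] (h : IsSkewMorphism φ) {b : G}
    (hb : ∀ g : G, g ∈ Subgroup.zpowers b) (hG : 1 < Nat.card G) :
    orderOf φ < Nat.card G := by
  have hb1 : b ≠ 1 := by
    rintro rfl
    have : orderOf (1 : G) = Nat.card G := orderOf_eq_card_of_forall_mem_zpowers hb
    simp at this
    omega
  have h1 := h.orderOf_pow_le hb 1 (S := {1}ᶜ) (fun j hj => hb1 (by
    rw [pow_one] at hj
    exact (φ ^ j).injective (hj.trans (h.pow_apply_one j).symm)))
  rw [pow_one] at h1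
  have h2 : Nat.card (({1}ᶜ : Set G)) + Nat.card (({1} : Set G)) = Nat.card G := by
    rw [Nat.card_coe_set_eq, Nat.card_coe_set_eq, add_comm, Set.ncard_add_ncard_compl]
  simp only [Nat.card_unique] at h2
  omega

end Group

/-! ### The kernel and the induced skew morphism of the quotient -/

section CommGroup

variable {G : Type*} [CommGroup G] {φ : Equiv.Perm G}

/-- The kernel of a skew morphism: the elements `a` for which the exponent in
`φ (a * c) = φ a * φ ^ i (c)` can be taken to be `1`. -/
def skewKernel (h : IsSkewMorphism φ) : Subgroup G where
  carrier := {a | ∀ c, φ (a * c) = φ a * φ c}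
  one_mem' c := by rw [h.1, one_mul, one_mul]
  mul_mem' {a a'} ha ha' c := by rw [mul_assoc, ha, ha', ha, mul_assoc]
  inv_mem' {a} ha := by
    have key : ∀ c, φ (a⁻¹ * c) = (φ a)⁻¹ * φ c := fun c => by
      rw [eq_inv_mul_iff_mul_eq, ← ha, mul_inv_cancel_left]
    intro c
    have h1 := key 1
    rw [mul_one, h.1, mul_one] at h1
    rw [key, h1]

variable (h : IsSkewMorphism φ)

theorem skewKernel_eq_top_iff : skewKernel h = ⊤ ↔ IsAutomorphism φ := by
  rw [isAutomorphism_iff, Subgroup.eq_top_iff']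
  rfl

/-- Elements with the same exponent lie in the same coset of the kernel. -/
theorem inv_mul_mem_skewKernel {a a' : G} (e : G → G) (ha : ∀ c, φ (a * c) = φ a * e c)
    (ha' : ∀ c, φ (a' * c) = φ a' * e c) : a⁻¹ * a' ∈ skewKernel h := by
  have key : ∀ c, φ (a⁻¹ * a' * c) = φ a' * (φ a)⁻¹ * φ c := fun c => by
    have h1 := ha (a⁻¹ * c)
    rw [mul_inv_cancel_left] at h1
    rw [h1, show a⁻¹ * a' * c = a' * (a⁻¹ * c) by
      rw [mul_comm a⁻¹ a', mul_assoc], ha', mul_assoc, inv_mul_cancel_left]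
  intro c
  have h1 := key 1
  rw [mul_one, h.1, mul_one] at h1
  rw [key, h1]

/-- If the exponents are determined by labels in a set of size `M`, then the kernel has index at
most `M`. -/
theorem card_quotient_skewKernel_le [Finite G] {α : Type*} [Finite α] (f : G → α)
    (hf : ∀ a a', f a = f a' → a⁻¹ * a' ∈ skewKernel h) :
    Nat.card (G ⧸ skewKernel h) ≤ Nat.card α := by
  refine Nat.card_le_card_of_injective (fun x : G ⧸ skewKernel h => f x.out) fun x y hxy => ?_
  have h1 := hf _ _ hxy
  rw [← QuotientGroup.eq] at h1
  simpa using h1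

/-- The exponents are nonzero modulo the order of `φ`, so the kernel has fewer cosets than `φ` has
powers. -/
theorem card_quotient_skewKernel_lt_orderOf [Finite G] (h1 : φ ≠ 1) :
    Nat.card (G ⧸ skewKernel h) < orderOf φ := by
  choose e he hee using h.2
  have hpow : ∀ i, φ ^ (i % orderOf φ) = φ ^ i := fun i => pow_mod_orderOf φ i
  have h0 := orderOf_pos φ
  have hne : ∀ a, e a % orderOf φ ∈ Set.Ioo 0 (orderOf φ) := by
    intro a
    refine ⟨Nat.pos_of_ne_zero fun h2 => h1 ?_, Nat.mod_lt _ h0⟩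
    have h3 : ∀ c, φ (a * c) = φ a * c := fun c => by
      rw [hee, ← hpow, h2]; rfl
    have h4 : φ a = a := by
      have := h3 a⁻¹
      rw [mul_inv_cancel, h.1] at this
      rw [eq_mul_inv_iff_mul_eq, one_mul] at this
      exact this.symm
    ext c
    have := h3 (a⁻¹ * c)
    rw [h4, mul_inv_cancel_left] at this
    exact this
  have h2 := card_quotient_skewKernel_le h
    (fun a => (⟨e a % orderOf φ, hne a⟩ : Set.Ioo 0 (orderOf φ))) (fun a a' haa => by
      have haa' : e a % orderOf φ = e a' % orderOf φ := congrArg Subtype.val haa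
      refine inv_mul_mem_skewKernel h (⇑(φ ^ e a)) (hee a) (fun c => ?_)
      rw [← hpow, haa', hpow, hee])
  have h3 : Nat.card (Set.Ioo 0 (orderOf φ)) = orderOf φ - 1 := by
    simp [Nat.card_eq_fintype_card]
  have h4 := h2.trans_eq h3
  omega

theorem card_skewKernel_ne_one [Finite G] {b : G} (hb : ∀ g : G, g ∈ Subgroup.zpowers b)
    (hG : 1 < Nat.card G) : Nat.card (skewKernel h) ≠ 1 := by
  intro h1
  have h2 := Subgroup.card_eq_card_quotient_mul_card_subgroup (skewKernel h)
  by_cases hφ : φ = 1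
  · have h3 : skewKernel h = ⊤ := by
      rw [skewKernel_eq_top_iff, isAutomorphism_iff]
      intro a c
      rw [hφ]; rfl
    rw [h3, Subgroup.card_top] at h1
    omega
  · have h3 := card_quotient_skewKernel_lt_orderOf h hφ
    have h4 := h.orderOf_lt_card hb hG
    rw [h1, mul_one] at h2
    omega

/-- A finite cyclic group has at most one subgroup of each order. -/
theorem subgroup_eq_ker_pow [Finite G] {b : G} (hb : ∀ g : G, g ∈ Subgroup.zpowers b)
    (K : Subgroup G) : K = (powMonoidHom (Nat.card K) : G →* G).ker := by
  have : IsCyclic G := ⟨⟨b, hb⟩⟩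
  refine Subgroup.eq_of_le_of_card_ge (fun x hx => ?_) ?_
  · rw [MonoidHom.mem_ker, powMonoidHom_apply]
    exact congrArg Subtype.val (pow_card_eq_one' (x := (⟨x, hx⟩ : K)))
  · rw [IsCyclic.card_powMonoidHom_ker]
    exact Nat.gcd_le_right _ Nat.card_pos

theorem subgroup_eq_of_card_eq [Finite G] {b : G} (hb : ∀ g : G, g ∈ Subgroup.zpowers b)
    {K L : Subgroup G} (hKL : Nat.card K = Nat.card L) : K = L := by
  rw [subgroup_eq_ker_pow hb K, subgroup_eq_ker_pow hb L, hKL]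

theorem mk_mem_zpowers {b : G} (hb : ∀ g : G, g ∈ Subgroup.zpowers b) {K : Subgroup G} (x : G ⧸ K) :
    x ∈ Subgroup.zpowers (b : G ⧸ K) := by
  obtain ⟨g, rfl⟩ := QuotientGroup.mk_surjective x
  obtain ⟨n, rfl⟩ := hb g
  exact ⟨n, rfl⟩

theorem zpow_mem_iff {b : G} (hb : ∀ g : G, g ∈ Subgroup.zpowers b) (K : Subgroup G) (n : ℤ) :
    b ^ n ∈ K ↔ (Nat.card (G ⧸ K) : ℤ) ∣ n := by
  rw [← orderOf_eq_card_of_forall_mem_zpowers fun x : G ⧸ K => mk_mem_zpowers hb x,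
    orderOf_dvd_iff_zpow_eq_one, ← QuotientGroup.eq_one_iff, QuotientGroup.mk_zpow]

theorem apply_mul_of_mem {c k : G} (hk : k ∈ skewKernel h) : φ (c * k) = φ c * φ k := by
  rw [mul_comm, hk, mul_comm]

/-- The restriction of a skew morphism to its kernel is a homomorphism. -/
def skewKernelHom : skewKernel h →* G where
  toFun k := φ k
  map_one' := h.1
  map_mul' x y := x.2 y

theorem apply_zpow_of_mem {k : G} (hk : k ∈ skewKernel h) (t : ℤ) : φ (k ^ t) = φ k ^ t :=
  map_zpow (skewKernelHom h) ⟨k, hk⟩ t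

variable [Finite G] {b : G} (hb : ∀ g : G, g ∈ Subgroup.zpowers b)

include hb

/-- The kernel is mapped onto a subgroup of the same order, hence onto itself. -/
theorem apply_mem_skewKernel {k : G} (hk : k ∈ skewKernel h) : φ k ∈ skewKernel h := by
  have hf : Function.Injective (skewKernelHom h) := fun x y hxy => Subtype.ext (φ.injective hxy)
  have h1 : (skewKernelHom h).range = skewKernel h := by
    refine subgroup_eq_of_card_eq hb ?_
    exact (Nat.card_congr (MonoidHom.ofInjective hf).toEquiv).symm
  rw [← h1]
  exact ⟨⟨k, hk⟩, rfl⟩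

theorem pow_apply_mem_skewKernel {k : G} (hk : k ∈ skewKernel h) (j : ℕ) :
    (φ ^ j) k ∈ skewKernel h := by
  induction j with
  | zero => exact hk
  | succ j ih =>
    rw [pow_succ', Equiv.Perm.mul_apply]
    exact apply_mem_skewKernel h hb ih

theorem pow_apply_mul_of_mem {c k : G} (hk : k ∈ skewKernel h) (j : ℕ) :
    (φ ^ j) (c * k) = (φ ^ j) c * (φ ^ j) k := by
  induction j with
  | zero => rfl
  | succ j ih =>
    rw [pow_succ', Equiv.Perm.mul_apply, ih,
      apply_mul_of_mem h (pow_apply_mem_skewKernel h hb hk j)]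
    rfl

theorem apply_mem_skewKernel_iff {k : G} : φ k ∈ skewKernel h ↔ k ∈ skewKernel h := by
  refine ⟨fun hk => ?_, apply_mem_skewKernel h hb⟩
  have h1 := pow_apply_mem_skewKernel h hb hk (orderOf φ - 1)
  rwa [← Equiv.Perm.mul_apply, ← pow_succ, Nat.sub_add_cancel (orderOf_pos φ),
    pow_orderOf_eq_one] at h1

/-- The permutation of the quotient by the kernel that is induced by a skew morphism. -/
noncomputable def quotientPerm : Equiv.Perm (G ⧸ skewKernel h) :=
  Equiv.ofBijective
    (Quotient.map' φ fun a c hac => by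
      rw [QuotientGroup.leftRel_apply] at hac ⊢
      have h1 := apply_mul_of_mem h (c := a) hac
      rw [mul_inv_cancel_left] at h1
      rw [h1, inv_mul_cancel_left]
      exact apply_mem_skewKernel h hb hac)
    (by
      refine (Finite.injective_iff_bijective.1 (Finite.injective_iff_surjective.2 ?_))
      intro x
      obtain ⟨g, rfl⟩ := QuotientGroup.mk_surjective x
      obtain ⟨c, rfl⟩ := φ.surjective g
      exact ⟨(c : G ⧸ skewKernel h), rfl⟩)

theorem quotientPerm_mk (c : G) :
    quotientPerm h hb (c : G ⧸ skewKernel h) = (φ c : G ⧸ skewKernel h) := rfl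

theorem quotientPerm_pow_mk (j : ℕ) (c : G) :
    (quotientPerm h hb ^ j) (c : G ⧸ skewKernel h) = ((φ ^ j) c : G ⧸ skewKernel h) := by
  induction j with
  | zero => rfl
  | succ j ih =>
    rw [pow_succ', pow_succ', Equiv.Perm.mul_apply, ih, quotientPerm_mk, Equiv.Perm.mul_apply]

theorem isSkewMorphism_quotientPerm : IsSkewMorphism (quotientPerm h hb) := by
  constructor
  · rw [← QuotientGroup.mk_one, quotientPerm_mk, h.1]
  · intro x
    obtain ⟨a, rfl⟩ := QuotientGroup.mk_surjective x
    obtain ⟨i, hi, hia⟩ := h.2 a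
    refine ⟨i, hi, fun y => ?_⟩
    obtain ⟨c, rfl⟩ := QuotientGroup.mk_surjective y
    rw [← QuotientGroup.mk_mul, quotientPerm_mk, quotientPerm_mk, quotientPerm_pow_mk, hia,
      QuotientGroup.mk_mul]

/-- A power of `φ` that is trivial on the quotient by the kernel moves a generator inside its
coset, so it has order at most that of the kernel. -/
theorem orderOf_le_orderOf_quotientPerm_mul :
    orderOf φ ≤ orderOf (quotientPerm h hb) * Nat.card (skewKernel h) := by
  set N := orderOf (quotientPerm h hb) with hN
  have h1 := h.orderOf_pow_le hb N (S := (fun k => b * k) '' (skewKernel h : Set G)) (fun j => by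
    refine ⟨b⁻¹ * ((φ ^ N) ^ j) b, ?_, mul_inv_cancel_left _ _⟩
    rw [SetLike.mem_coe, ← QuotientGroup.eq, ← pow_mul, ← quotientPerm_pow_mk h hb, pow_mul, hN,
      pow_orderOf_eq_one, one_pow]
    rfl)
  rw [Nat.card_image_of_injective (mul_right_injective b)] at h1
  have h2 : φ ^ (N * orderOf (φ ^ N)) = 1 := by rw [pow_mul, pow_orderOf_eq_one]
  have h3 := Nat.le_of_dvd (Nat.mul_pos (orderOf_pos _) (orderOf_pos _))
    (orderOf_dvd_of_pow_eq_one h2)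
  exact h3.trans (Nat.mul_le_mul_left _ h1)

end CommGroup

/-! ### The smallest power acting trivially on the kernel and on its quotient -/

/-- The value at `b ^ n` of a map with `g (b * c) = g b * g c ^ κ` is a geometric sum. -/
theorem apply_pow_generator {G : Type*} [Group G] {b : G} {g : G → G} (hg1 : g 1 = 1) {κ : ℕ}
    (hκ : ∀ c, g (b * c) = g b * g c ^ κ) (n : ℕ) :
    g (b ^ n) = g b ^ (∑ i ∈ Finset.range n, κ ^ i) := by
  induction n with
  | zero => simpa using hg1
  | succ n ih =>
    rw [pow_succ', hκ, ih, ← pow_mul, ← pow_succ', Finset.sum_range_succ', Finset.sum_mul]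
    simp [pow_succ]

section Quotient

variable {G : Type*} [CommGroup G] [Finite G] {φ : Equiv.Perm G} (h : IsSkewMorphism φ) {b : G}
  (hb : ∀ g : G, g ∈ Subgroup.zpowers b)

include h hb

theorem exists_dvd_iff_trivial : ∃ N : ℕ, ∀ j, N ∣ j ↔
    (∀ k ∈ skewKernel h, (φ ^ j) k = k) ∧ ∀ c, c⁻¹ * (φ ^ j) c ∈ skewKernel h := by
  let ψ : Equiv.Perm (skewKernel h) := φ.subtypePerm fun x => apply_mem_skewKernel_iff h hb
  refine ⟨orderOf ((ψ, quotientPerm h hb) :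
    Equiv.Perm (skewKernel h) × Equiv.Perm (G ⧸ skewKernel h)), fun j => ?_⟩
  rw [orderOf_dvd_iff_pow_eq_one, Prod.pow_mk, Prod.mk_eq_one]
  refine and_congr ?_ ?_
  · rw [Equiv.Perm.ext_iff, Subtype.forall]
    refine forall₂_congr fun k hk => ?_
    simp [ψ, Equiv.Perm.subtypePerm_pow, Subtype.ext_iff]
  · rw [Equiv.Perm.ext_iff, QuotientGroup.forall_mk]
    refine forall_congr' fun c => ?_
    rw [quotientPerm_pow_mk, Equiv.Perm.one_apply, ← QuotientGroup.eq]
    exact eq_comm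

/-- If the induced skew morphism of the quotient by the kernel `K` is an automorphism, let `N` be
the least exponent for which `φ ^ N` is trivial on `K` and on the quotient. Then `φ ^ N` moves each
`c` by an element `g c` of `K` that depends on the coset of `c` only, it is a skew morphism (with
exponents `κ`), and all exponents of `φ` itself are `1` modulo `N`. -/
theorem exists_translation_power (hq : IsAutomorphism (quotientPerm h hb)) :
    ∃ (N : ℕ) (g : G → G),
      (∀ j, N ∣ j ↔
        (∀ k ∈ skewKernel h, (φ ^ j) k = k) ∧ ∀ c, c⁻¹ * (φ ^ j) c ∈ skewKernel h) ∧
      (∀ c, g c ∈ skewKernel h) ∧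
      (∀ j c, (φ ^ (N * j)) c = c * g c ^ j) ∧
      (∀ c, ∀ k ∈ skewKernel h, g (c * k) = g c) ∧
      (∀ a, ∃ κ : ℕ, ∀ c, g (a * c) = g a * g c ^ κ) ∧
      (∀ a, ∃ m : ℕ, ∀ c, φ (a * c) = φ a * φ (c * g c ^ m)) := by
  obtain ⟨N, hdvd⟩ := exists_dvd_iff_trivial h hb
  obtain ⟨hNK, hNQ⟩ := (hdvd N).1 dvd_rfl
  have hpow : ∀ j c, (φ ^ (N * j)) c = c * (c⁻¹ * (φ ^ N) c) ^ j := by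
    intro j c
    induction j with
    | zero => simp
    | succ j ih =>
      have hm := (skewKernel h).pow_mem (hNQ c) j
      rw [Nat.mul_succ, add_comm, pow_add, Equiv.Perm.mul_apply, ih, pow_apply_mul_of_mem h hb hm,
        hNK _ hm, pow_succ', ← mul_assoc, mul_inv_cancel_left]
  refine ⟨N, fun c => c⁻¹ * (φ ^ N) c, hdvd, hNQ, hpow, ?_, ?_, ?_⟩
  · intro c k hk
    dsimp only
    rw [pow_apply_mul_of_mem h hb hk, hNK k hk]
    apply Additive.ofMul.injective
    simp only [ofMul_mul, ofMul_inv]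
    abel
  · intro a
    obtain ⟨i, hi⟩ := h.pow_apply_mul N a
    have hNi : N ∣ i := by
      rw [hdvd]
      constructor
      · intro k hk
        have h1 := hi k
        rw [pow_apply_mul_of_mem h hb hk, hNK k hk] at h1
        exact (mul_left_cancel h1).symm
      · intro c
        have h1 := hi c
        have h2 := (skewKernel h).mul_mem (hNQ (a * c)) ((skewKernel h).inv_mem (hNQ a))
        rw [h1] at h2
        convert h2 using 1
        apply Additive.ofMul.injective
        simp only [ofMul_mul, ofMul_inv]
        abel
    obtain ⟨κ, rfl⟩ := hNi
    refine ⟨κ, fun c => ?_⟩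
    dsimp only
    rw [hi, hpow]
    apply Additive.ofMul.injective
    simp only [ofMul_mul, ofMul_inv, ofMul_pow]
    abel
  · intro a
    obtain ⟨i, hi0, hi⟩ := h.2 a
    obtain ⟨i, rfl⟩ : ∃ i', i = i' + 1 := ⟨i - 1, by omega⟩
    have hNi : N ∣ i := by
      rw [hdvd]
      constructor
      · intro k hk
        have h1 := hi k
        rw [apply_mul_of_mem h hk, pow_succ', Equiv.Perm.mul_apply] at h1
        exact (φ.injective (mul_left_cancel h1)).symm
      · intro c
        have h1 := isAutomorphism_iff.1 hq (a : G ⧸ skewKernel h) (c : G ⧸ skewKernel h)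
        rw [← QuotientGroup.mk_mul, quotientPerm_mk, hi, QuotientGroup.mk_mul, quotientPerm_mk,
          pow_succ', Equiv.Perm.mul_apply, ← quotientPerm_mk h hb ((φ ^ i) c)] at h1
        have h2 := (quotientPerm h hb).injective (mul_left_cancel h1)
        exact QuotientGroup.eq.1 h2.symm
    obtain ⟨m, rfl⟩ := hNi
    refine ⟨m, fun c => ?_⟩
    rw [hi, pow_succ', Equiv.Perm.mul_apply, hpow]

/-- A skew morphism with automorphic quotient is an automorphism as soon as its least power acting
trivially on kernel and quotient has a fixed point in the coset of a generator. -/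
theorem isAutomorphism_of_apply_eq_one {N : ℕ} {g : G → G}
    (hpow : ∀ j c, (φ ^ (N * j)) c = c * g c ^ j)
    (hφ : ∀ a, ∃ m : ℕ, ∀ c, φ (a * c) = φ a * φ (c * g c ^ m)) (hgb : g b = 1) :
    IsAutomorphism φ := by
  have h1 : φ ^ (N * 1) = 1 := h.pow_eq_one_of_apply_eq hb (by rw [hpow, hgb]; simp)
  have h2 : ∀ c, g c = 1 := fun c => by
    have := hpow 1 c
    rw [h1, Equiv.Perm.one_apply, pow_one] at this
    exact (mul_eq_left.1 this.symm)
  rw [isAutomorphism_iff]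
  intro a c
  obtain ⟨m, hm⟩ := hφ a
  rw [hm, h2, one_pow, mul_one]

/-- If the quotient is an automorphism, then the index of the kernel is at most its order. -/
theorem card_quotient_le_of_isAutomorphism (hq : IsAutomorphism (quotientPerm h hb)) :
    Nat.card (G ⧸ skewKernel h) ≤ Nat.card (skewKernel h) := by
  obtain ⟨N, g, -, hgK, -, -, -, hφ⟩ := exists_translation_power h hb hq
  choose m hm using hφ
  have hpos : 0 < Nat.card (skewKernel h) := Nat.card_pos
  have := card_quotient_skewKernel_le h
    (fun a => (⟨m a % Nat.card (skewKernel h), Nat.mod_lt _ hpos⟩ : Fin (Nat.card (skewKernel h))))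
    (fun a a' haa => by
      have haa' := congrArg Fin.val haa
      have hred : ∀ a c, g c ^ (m a % Nat.card (skewKernel h)) = g c ^ m a := fun a c =>
        congrArg Subtype.val (pow_mod_natCard (⟨g c, hgK c⟩ : skewKernel h) (m a))
      refine inv_mul_mem_skewKernel h (fun c => φ (c * g c ^ m a)) (hm a) fun c => ?_
      dsimp only at haa' ⊢
      rw [hm, ← hred a, haa', hred a'])
  simpa using this

/-! ### Skew morphisms of cyclic groups of order `p`, `4` and `2p` -/

theorem isAutomorphism_of_card_prime (hp : (Nat.card G).Prime) : IsAutomorphism φ := by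
  rw [← skewKernel_eq_top_iff h]
  refine Subgroup.eq_top_of_card_eq _ ?_
  exact ((Nat.dvd_prime hp).1 (Subgroup.card_subgroup_dvd_card _)).resolve_left
    (card_skewKernel_ne_one h hb hp.one_lt)

theorem orderOf_le_card_skewKernel_of_index_two (h2 : Nat.card (G ⧸ skewKernel h) = 2) :
    orderOf φ ≤ Nat.card (skewKernel h) := by
  have h1 := (isSkewMorphism_quotientPerm h hb).orderOf_lt_card (fun x => mk_mem_zpowers hb x)
    (by omega)
  have h3 := orderOf_le_orderOf_quotientPerm_mul h hb
  have h4 := orderOf_pos (quotientPerm h hb)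
  have h5 : orderOf (quotientPerm h hb) = 1 := by omega
  rwa [h5, one_mul] at h3

theorem isAutomorphism_of_card_four (h4 : Nat.card G = 4) : IsAutomorphism φ := by
  have h1 := Subgroup.card_eq_card_quotient_mul_card_subgroup (skewKernel h)
  have h2 := card_skewKernel_ne_one h hb (by omega)
  have h3 : Nat.card (skewKernel h) ∣ 4 := h4 ▸ Subgroup.card_subgroup_dvd_card _
  have h5 := Nat.le_of_dvd (by norm_num) h3
  by_contra hφ
  have hne : φ ≠ 1 := by
    rintro rfl
    exact hφ (isAutomorphism_iff.2 fun _ _ => rfl)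
  have h6 := card_quotient_skewKernel_lt_orderOf h hne
  rw [← skewKernel_eq_top_iff h] at hφ
  have h7 : Nat.card (skewKernel h) ≠ 4 := fun h7 =>
    hφ (Subgroup.eq_top_of_card_eq _ (h7.trans h4.symm))
  interval_cases hc : Nat.card (skewKernel h)
  · omega
  · omega
  · have h8 := orderOf_le_card_skewKernel_of_index_two h hb (by omega)
    omega
  · omega
  · omega

theorem isAutomorphism_or_orderOf_le_of_card_two_mul {p : ℕ} (hp : p.Prime) (hp2 : p ≠ 2)
    (hG : Nat.card G = 2 * p) : IsAutomorphism φ ∨ orderOf φ ≤ p := by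
  have hp3 := hp.two_le
  have h1 := Subgroup.card_eq_card_quotient_mul_card_subgroup (skewKernel h)
  have h2 := card_skewKernel_ne_one h hb (by omega)
  have h3 : Nat.card (skewKernel h) ∣ 2 * p := hG ▸ Subgroup.card_subgroup_dvd_card _
  obtain ⟨x, y, hx, hy, hxy⟩ := exists_dvd_and_dvd_of_dvd_mul h3
  rw [hxy] at h1 h2
  rcases (Nat.dvd_prime Nat.prime_two).1 hx with rfl | rfl <;>
    rcases (Nat.dvd_prime hp).1 hy with rfl | rfl
  · omega
  · right
    have h4 := orderOf_le_card_skewKernel_of_index_two h hb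
      (Nat.eq_of_mul_eq_mul_right hp.pos (by rw [← hG, h1, one_mul]))
    omega
  · left
    have h4 : Nat.card (G ⧸ skewKernel h) = p := by omega
    have h5 := card_quotient_le_of_isAutomorphism h hb
      (isAutomorphism_of_card_prime (isSkewMorphism_quotientPerm h hb)
        (fun x => mk_mem_zpowers hb x) (h4 ▸ hp))
    omega
  · left
    rw [← skewKernel_eq_top_iff h]
    exact Subgroup.eq_top_of_card_eq _ (hxy.trans hG.symm)

/-! ### The kernel of a skew morphism of a cyclic group of order `4p` -/

/-- With a kernel of order `4` and odd index `n`, the geometric sum over `n` terms is odd, which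
forces the translation part to vanish. -/
theorem isAutomorphism_of_card_skewKernel_four (hK : Nat.card (skewKernel h) = 4)
    (hodd : Odd (Nat.card (G ⧸ skewKernel h))) (hq : IsAutomorphism (quotientPerm h hb)) :
    IsAutomorphism φ := by
  obtain ⟨N, g, -, hgK, hpow, hgk, hκ, hφ⟩ := exists_translation_power h hb hq
  refine isAutomorphism_of_apply_eq_one h hb hpow hφ ?_
  have hg1 : g 1 = 1 := by
    have := hpow 1 1
    rwa [h.pow_apply_one, one_mul, pow_one, eq_comm] at this
  obtain ⟨κ, hκ⟩ := hκ b
  set n := Nat.card (G ⧸ skewKernel h)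
  have h1 : g (b ^ n) = 1 := by
    have hbn : b ^ n ∈ skewKernel h := by
      rw [← QuotientGroup.eq_one_iff, QuotientGroup.mk_pow]
      exact pow_card_eq_one'
    rw [← one_mul (b ^ n), hgk 1 _ hbn, hg1]
  rw [apply_pow_generator hg1 hκ] at h1
  have hS : Odd (∑ i ∈ Finset.range n, κ ^ i) := by
    rcases Nat.even_or_odd κ with hκ | hκ
    · obtain ⟨n', hn'⟩ : ∃ n', n = n' + 1 := ⟨n - 1, by obtain ⟨r, hr⟩ := hodd; omega⟩
      rw [hn', Finset.sum_range_succ', pow_zero]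
      refine Even.add_one (Finset.even_sum _ fun i _ => ?_)
      exact hκ.pow_of_ne_zero (Nat.succ_ne_zero i)
    · rw [Finset.odd_sum_iff_odd_card_odd, Finset.filter_true_of_mem fun i _ => hκ.pow,
        Finset.card_range]
      exact hodd
  have h2 : g b ^ 4 = 1 := by
    rw [← hK]
    exact congrArg Subtype.val (pow_card_eq_one' (x := (⟨g b, hgK b⟩ : skewKernel h)))
  have h3 : Nat.Coprime (∑ i ∈ Finset.range n, κ ^ i) 4 :=
    Nat.Coprime.pow_right 2 (Nat.coprime_two_right.2 hS)
  have h4 := Nat.dvd_gcd (orderOf_dvd_of_pow_eq_one h1) (orderOf_dvd_of_pow_eq_one h2)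
  rw [h3.gcd_eq_one, Nat.dvd_one] at h4
  exact orderOf_eq_one_iff.1 h4

theorem card_skewKernel_eq {p : ℕ} (hp : p.Prime) (hp2 : p ≠ 2) (hG : Nat.card G = 4 * p)
    (hφ : ¬ IsAutomorphism φ) :
    Nat.card (skewKernel h) = p ∨ Nat.card (skewKernel h) = 2 * p := by
  have hp3 := hp.two_le
  have h1 := Subgroup.card_eq_card_quotient_mul_card_subgroup (skewKernel h)
  have h2 := card_skewKernel_ne_one h hb (by omega)
  have h3 : Nat.card (skewKernel h) ∣ 4 * p := hG ▸ Subgroup.card_subgroup_dvd_card _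
  have hQ := isSkewMorphism_quotientPerm h hb
  have hQb : ∀ x : G ⧸ skewKernel h, x ∈ Subgroup.zpowers (b : G ⧸ skewKernel h) :=
    fun x => mk_mem_zpowers hb x
  obtain ⟨x, y, hx, hy, hxy⟩ := exists_dvd_and_dvd_of_dvd_mul h3
  have hx4 := Nat.le_of_dvd (by norm_num) hx
  rw [hxy] at h1 h2 ⊢
  rcases (Nat.dvd_prime hp).1 hy with rfl | rfl <;> interval_cases x
  · omega
  · omega
  · exfalso
    have h4 : Nat.card (G ⧸ skewKernel h) = 2 * p := by omega
    rcases isAutomorphism_or_orderOf_le_of_card_two_mul hQ hQb hp hp2 h4 with h5 | h5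
    · have h6 := card_quotient_le_of_isAutomorphism h hb h5
      omega
    · have hne : φ ≠ 1 := by
        rintro rfl
        exact hφ (isAutomorphism_iff.2 fun _ _ => rfl)
      have h6 := card_quotient_skewKernel_lt_orderOf h hne
      have h7 := orderOf_le_orderOf_quotientPerm_mul h hb
      rw [hxy] at h7
      omega
  · omega
  · exfalso
    have h4 : Nat.card (G ⧸ skewKernel h) = p := by omega
    exact hφ (isAutomorphism_of_card_skewKernel_four h hb hxy
      (h4 ▸ hp.odd_of_ne_two hp2) (isAutomorphism_of_card_prime hQ hQb (h4 ▸ hp)))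
  · omega
  · left; omega
  · right; rfl
  · omega
  · exact absurd ((skewKernel_eq_top_iff h).1 (Subgroup.eq_top_of_card_eq _ (hxy.trans hG.symm))) hφ

end Quotient

/-! ### The shift permutations -/

section Shift

variable {G : Type*} [Group G] {p : ℕ} {b : G}

theorem oddShift_apply_odd (hG : Nat.card G = 4 * p) (hb : ∀ g : G, g ∈ Subgroup.zpowers b)
    {s : ℤ} (hs : (2 : ℤ) ∣ s) (t : ℤ) :
    oddShift b s hs (b ^ (2 * t + 1)) = b ^ (2 * t + 1 + s) := by
  have h := zpow_mem_zpowers_zpow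
    (show (2 : ℤ) ∣ orderOf b from dvd_trans (by norm_num) (four_dvd_orderOf hG hb))
  simp only [oddShift, cosetShift, Equiv.coe_fn_mk, h]
  rw [if_neg (by omega), ← zpow_add]

theorem oddShift_apply_even (hG : Nat.card G = 4 * p) (hb : ∀ g : G, g ∈ Subgroup.zpowers b)
    {s : ℤ} (hs : (2 : ℤ) ∣ s) (t : ℤ) :
    oddShift b s hs (b ^ (2 * t)) = b ^ (2 * t) := by
  have h := zpow_mem_zpowers_zpow
    (show (2 : ℤ) ∣ orderOf b from dvd_trans (by norm_num) (four_dvd_orderOf hG hb))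
  simp only [oddShift, cosetShift, Equiv.coe_fn_mk, h]
  rw [if_pos (by omega), mul_one]

theorem zpow_eq_zpow_iff_dvd (hG : Nat.card G = 4 * p) (hb : ∀ g : G, g ∈ Subgroup.zpowers b)
    (m n : ℤ) : b ^ m = b ^ n ↔ (4 * p : ℤ) ∣ m - n := by
  have h : ((orderOf b : ℕ) : ℤ) = 4 * p := by
    rw [orderOf_eq_card_of_forall_mem_zpowers hb, hG]; push_cast; rfl
  rw [← h, orderOf_dvd_iff_zpow_eq_one, zpow_sub, mul_inv_eq_one]

theorem isAutomorphism_oddShift_iff (hG : Nat.card G = 4 * p)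
    (hb : ∀ g : G, g ∈ Subgroup.zpowers b) {s : ℤ} (hs : (2 : ℤ) ∣ s) :
    IsAutomorphism (oddShift b s hs) ↔ (2 * p : ℤ) ∣ s := by
  have hodd := oddShift_apply_odd hG hb hs
  have heven := oddShift_apply_even hG hb hs
  rw [isAutomorphism_iff]
  constructor
  · intro h
    have h1 := h (b ^ (2 * 0 + 1 : ℤ)) (b ^ (2 * 0 + 1 : ℤ))
    rw [← zpow_add, show (2 * 0 + 1 + (2 * 0 + 1) : ℤ) = 2 * 1 by norm_num, heven, hodd,
      ← zpow_add, zpow_eq_zpow_iff_dvd hG hb] at h1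
    obtain ⟨r, hr⟩ := h1
    exact ⟨-r, by linarith⟩
  · rintro ⟨r, hr⟩ a c
    obtain ⟨x, rfl⟩ := hb a
    obtain ⟨y, rfl⟩ := hb c
    dsimp only
    rw [← zpow_add]
    rcases Int.even_or_odd' x with ⟨m, rfl | rfl⟩ <;>
      rcases Int.even_or_odd' y with ⟨n, rfl | rfl⟩
    · rw [← mul_add, heven, heven, heven, ← zpow_add, mul_add]
    · rw [← add_assoc, ← mul_add, heven, hodd, hodd, ← zpow_add]
      congr 1; ring
    · rw [show 2 * m + 1 + 2 * n = 2 * (m + n) + 1 by ring, heven, hodd, hodd, ← zpow_add]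
      congr 1; ring
    · rw [show 2 * m + 1 + (2 * n + 1) = 2 * (m + n + 1) by ring, heven, hodd, hodd, ← zpow_add,
        zpow_eq_zpow_iff_dvd hG hb]
      exact ⟨-r, by rw [hr]; ring⟩

theorem oddShift_pow_apply_odd (hG : Nat.card G = 4 * p) (hb : ∀ g : G, g ∈ Subgroup.zpowers b)
    {s : ℤ} (hs : (2 : ℤ) ∣ s) (j : ℕ) (t : ℤ) :
    (oddShift b s hs ^ j) (b ^ (2 * t + 1)) = b ^ (2 * t + 1 + j * s) := by
  induction j with
  | zero => simp
  | succ j ih =>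
    obtain ⟨r, rfl⟩ := hs
    rw [pow_succ', Equiv.Perm.mul_apply, ih,
      show 2 * t + 1 + (j : ℤ) * (2 * r) = 2 * (t + j * r) + 1 by ring, oddShift_apply_odd hG hb]
    congr 1
    push_cast
    ring

/-- The exponents of `oddShift` are `1` at the even powers of `b` and `-1` at the odd ones. -/
theorem isSkewMorphism_oddShift (hp : 0 < p) (hG : Nat.card G = 4 * p)
    (hb : ∀ g : G, g ∈ Subgroup.zpowers b) {s : ℤ} (hs : (2 : ℤ) ∣ s) :
    IsSkewMorphism (oddShift b s hs) := by
  have hodd := oddShift_apply_odd hG hb hs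
  have heven := oddShift_apply_even hG hb hs
  refine ⟨by simpa using heven 0, fun a => ?_⟩
  obtain ⟨x, rfl⟩ := hb a
  dsimp only
  rcases Int.even_or_odd' x with ⟨m, rfl | rfl⟩
  · refine ⟨1, one_pos, fun c => ?_⟩
    obtain ⟨y, rfl⟩ := hb c
    dsimp only
    rw [pow_one, ← zpow_add]
    rcases Int.even_or_odd' y with ⟨n, rfl | rfl⟩
    · rw [← mul_add, heven, heven, heven, ← zpow_add, mul_add]
    · rw [← add_assoc, ← mul_add, heven, hodd, hodd, ← zpow_add]
      congr 1; ring
  · refine ⟨4 * p - 1, by omega, fun c => ?_⟩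
    obtain ⟨y, rfl⟩ := hb c
    dsimp only
    rw [← zpow_add]
    rcases Int.even_or_odd' y with ⟨n, rfl | rfl⟩
    · have hfix : (oddShift b s hs ^ (4 * p - 1)) (b ^ (2 * n)) = b ^ (2 * n) :=
        (pow_apply_eq_self_iff _ _ _).2 (((pow_apply_eq_self_iff _ 1 _).1 (heven n)).trans
          (one_dvd _))
      rw [show 2 * m + 1 + 2 * n = 2 * (m + n) + 1 by ring, hodd, hodd, hfix, ← zpow_add]
      congr 1; ring
    · rw [show 2 * m + 1 + (2 * n + 1) = 2 * (m + n + 1) by ring, heven, hodd,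
        oddShift_pow_apply_odd hG hb, ← zpow_add, zpow_eq_zpow_iff_dvd hG hb,
        Nat.cast_sub (by omega)]
      refine ⟨-s, ?_⟩
      push_cast
      ring

/-- The exponents of `zPerm b ω i` are the powers of `ω`: at `b ^ r` modulo `b ^ 4` the shift is
`4 * i * (1 + ω + ⋯ + ω ^ (r - 1))`, and `1 + ω + ω ^ 2 + ω ^ 3 ≡ 0` modulo `p`. -/
theorem isSkewMorphism_zPerm (hp : 0 < p) (hG : Nat.card G = 4 * p)
    (hb : ∀ g : G, g ∈ Subgroup.zpowers b) {ω : ℤ} (hω : ω ^ 2 ≡ -1 [ZMOD p]) (i : ℤ) :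
    IsSkewMorphism (zPerm b ω i) := by
  obtain ⟨d, hd⟩ : (p : ℤ) ∣ ω ^ 2 + 1 := by
    have := hω.symm.dvd
    simpa using this
  have h0 : ∀ t : ℤ, zPerm b ω i (b ^ (4 * t)) = b ^ (4 * t) := fun t =>
    (zPerm_apply hG hb ω i t).2.2.2
  let f : ℤ → ℤ := fun r => if r = 1 then 1 else if r = 2 then ω + 1 else if r = 3 then ω else 0
  have hz : ∀ t r : ℤ, 0 ≤ r → r < 4 →
      zPerm b ω i (b ^ (4 * t + r)) = b ^ (4 * t + r + 4 * i * f r) := by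
    intro t r hr0 hr4
    obtain ⟨h1, h2, h3, h4⟩ := zPerm_apply hG hb ω i t
    interval_cases r
    · simpa [f] using h4
    · simpa [f] using h1
    · simpa [f] using h2
    · simpa [f] using h3
  have hzj : ∀ (j : ℕ) (t r : ℤ), 0 ≤ r → r < 4 →
      (zPerm b ω i ^ j) (b ^ (4 * t + r)) = b ^ (4 * t + r + j * (4 * i * f r)) := by
    intro j t r hr0 hr4
    induction j with
    | zero => simp
    | succ j ih =>
      rw [pow_succ', Equiv.Perm.mul_apply, ih,
        show 4 * t + r + (j : ℤ) * (4 * i * f r) = 4 * (t + j * (i * f r)) + r by ring,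
        hz _ r hr0 hr4]
      congr 1
      push_cast
      ring
  refine ⟨by simpa using h0 0, fun a => ?_⟩
  obtain ⟨x, rfl⟩ := hb a
  -- a positive integer congruent to `ω ^ r` modulo `p`, where `r` is `x` modulo `4`
  have hp' : (0 : ℤ) < p := by exact_mod_cast hp
  obtain ⟨e, he0, q, heq⟩ : ∃ e : ℕ, 0 < e ∧ ∃ q : ℤ, (e : ℤ) = ω ^ (x % 4).toNat + p * q := by
    set w := ω ^ (x % 4).toNat
    have h1 := Int.emod_nonneg w hp'.ne'
    have h2 := Int.mul_ediv_add_emod w p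
    refine ⟨(w % p + p).toNat, by omega, 1 - w / p, ?_⟩
    rw [Int.toNat_of_nonneg (by omega)]
    linarith
  refine ⟨e, he0, fun c => ?_⟩
  obtain ⟨y, rfl⟩ := hb c
  dsimp only
  have hx := Int.mul_ediv_add_emod x 4
  have hy := Int.mul_ediv_add_emod y 4
  have hx0 := Int.emod_nonneg x (show (4 : ℤ) ≠ 0 by norm_num)
  have hx4 := Int.emod_lt_of_pos x (show (0 : ℤ) < 4 by norm_num)
  have hy0 := Int.emod_nonneg y (show (4 : ℤ) ≠ 0 by norm_num)
  have hy4 := Int.emod_lt_of_pos y (show (0 : ℤ) < 4 by norm_num)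
  have hxy := Int.mul_ediv_add_emod (x % 4 + y % 4) 4
  have hxy0 := Int.emod_nonneg (x % 4 + y % 4) (show (4 : ℤ) ≠ 0 by norm_num)
  have hxy4 := Int.emod_lt_of_pos (x % 4 + y % 4) (show (0 : ℤ) < 4 by norm_num)
  -- the cocycle identity of the shifts
  have hf : (p : ℤ) ∣ f ((x % 4 + y % 4) % 4) - f (x % 4) - e * f (y % 4) := by
    rw [heq]
    clear heq hxy hxy0 hxy4 hx hy
    generalize x % 4 = r at *
    generalize y % 4 = r' at *
    interval_cases r <;> interval_cases r' <;> simp [f]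
    · exact ⟨-q * (ω + 1), by ring⟩
    · exact ⟨-q * ω, by ring⟩
    · exact ⟨-d - q * (ω + 1), by linear_combination (-1) * hd⟩
    · exact ⟨-d - q * ω, by linear_combination (-1) * hd⟩
    · exact ⟨-d - q, by linear_combination (-1) * hd⟩
    · exact ⟨-(1 + ω) * d - q * (ω + 1), by linear_combination (-(1 + ω)) * hd⟩
    · exact ⟨-ω * d - q * ω, by linear_combination (-ω) * hd⟩
    · exact ⟨-ω * d - q, by linear_combination (-ω) * hd⟩
    · exact ⟨(1 - ω ^ 2 - ω) * d - q * (ω + 1), by linear_combination (1 - ω ^ 2 - ω) * hd⟩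
    · exact ⟨(1 - ω ^ 2) * d - q * ω, by linear_combination (1 - ω ^ 2) * hd⟩
  obtain ⟨m, hm⟩ := hf
  rw [← zpow_add, show x + y = 4 * (x / 4 + y / 4 + (x % 4 + y % 4) / 4) + (x % 4 + y % 4) % 4 by
      linarith, hz _ _ hxy0 hxy4]
  nth_rw 5 [← hx]
  nth_rw 5 [← hy]
  rw [hz _ _ hx0 hx4, hzj _ _ _ hy0 hy4, ← zpow_add, zpow_eq_zpow_iff_dvd hG hb]
  refine ⟨i * m, ?_⟩
  linear_combination 4 * i * hm + hxy

theorem not_isAutomorphism_zPerm (hp : p.Prime) (hp2 : p ≠ 2) (hG : Nat.card G = 4 * p)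
    (hb : ∀ g : G, g ∈ Subgroup.zpowers b) {ω : ℤ} (hω : ω ^ 2 ≡ -1 [ZMOD p]) {i : ℤ}
    (hi : ¬ (p : ℤ) ∣ i) : ¬ IsAutomorphism (zPerm b ω i) := by
  intro h
  rw [isAutomorphism_iff] at h
  obtain ⟨h1, h2, -, -⟩ := zPerm_apply hG hb ω i 0
  have h3 := h (b ^ (4 * 0 + 1 : ℤ)) (b ^ (4 * 0 + 1 : ℤ))
  rw [← zpow_add, show (4 * 0 + 1 + (4 * 0 + 1) : ℤ) = 4 * 0 + 2 by norm_num, h1, h2,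
    ← zpow_add, zpow_eq_zpow_iff_dvd hG hb] at h3
  have hpp : Prime (p : ℤ) := Nat.prime_iff_prime_int.1 hp
  have h4 : (p : ℤ) ∣ i * (ω - 1) := by
    obtain ⟨r, hr⟩ := h3
    exact ⟨r, by linarith⟩
  have h5 := (hpp.dvd_or_dvd h4).resolve_left hi
  have h6 : (p : ℤ) ∣ ω ^ 2 + 1 := by simpa using hω.symm.dvd
  have h7 : (p : ℤ) ∣ 2 := by
    have := dvd_sub h6 (h5.mul_right (ω + 1))
    rwa [show ω ^ 2 + 1 - (ω - 1) * (ω + 1) = 2 by ring] at this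
  exact hp2 ((Nat.prime_dvd_prime_iff_eq hp Nat.prime_two).1 (by exact_mod_cast h7))

/-- A shift of the odd powers of `b` that is not an automorphism is one of the permutations `x_s`,
`y_s`. -/
theorem isX_or_isY_oddShift (hp : p.Prime) (hp2 : p ≠ 2) (hG : Nat.card G = 4 * p)
    (hb : ∀ g : G, g ∈ Subgroup.zpowers b) {s : ℤ} (hs : (2 : ℤ) ∣ s)
    (h : ¬ IsAutomorphism (oddShift b s hs)) :
    IsX p b (oddShift b s hs) ∨ IsY p b (oddShift b s hs) := by
  have hp0 := hp.pos
  have hodd := hp.odd_of_ne_two hp2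
  -- the shift depends on `s` modulo `4 * p` only
  have hper : ∀ (s' : ℤ) (hs' : (2 : ℤ) ∣ s'), (4 * p : ℤ) ∣ s - s' →
      oddShift b s hs = oddShift b s' hs' := by
    intro s' hs' hd
    have h1 := (zpow_eq_zpow_iff_dvd hG hb s s').2 hd
    simp only [oddShift, h1]
  rw [isAutomorphism_oddShift_iff hG hb hs] at h
  obtain ⟨r, rfl⟩ := hs
  obtain ⟨i, hi⟩ := Int.even_or_odd' r
  have h1 := Int.emod_nonneg i (show (p : ℤ) ≠ 0 by omega)
  have h2 := Int.emod_lt_of_pos i (show (0 : ℤ) < p by omega)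
  have h3 := Int.mul_ediv_add_emod i p
  have h4 : ((i % p).toNat : ℤ) = i % p := Int.toNat_of_nonneg h1
  rcases hi with rfl | rfl
  · right
    refine ⟨(i % p).toNat, ?_, by omega, ?_⟩
    · by_contra h5
      refine h ⟨2 * (i / p), ?_⟩
      rw [show i % p = 0 by omega, add_zero] at h3
      rw [← h3]
      simp only [Int.mul_ediv_cancel_left _ (show (p : ℤ) ≠ 0 by omega)]
      ring
    · refine hper _ _ ⟨i / p, ?_⟩
      rw [h4]
      linear_combination -4 * h3
  · left
    refine ⟨(i % p).toNat, by omega, ?_, ?_⟩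
    · intro h5
      obtain ⟨m, hm⟩ := hodd
      refine h ⟨2 * (i / p) + 1, ?_⟩
      have h6 : i % p = m := by omega
      rw [h6] at h3
      rw [hm] at h3 ⊢
      push_cast at h3 ⊢
      linear_combination -4 * h3
    · refine hper _ _ ⟨i / p, ?_⟩
      rw [h4]
      linear_combination -4 * h3

end Shift

section Classification

variable {G : Type*} [CommGroup G] [Finite G] {φ : Equiv.Perm G} (h : IsSkewMorphism φ) {b : G}
  (hb : ∀ g : G, g ∈ Subgroup.zpowers b) {p : ℕ}

include h hb

/-! ### Kernels of index two -/

/-- If `φ b = b ^ (2 * s + 1)` and `φ (b ^ 2) = b ^ (2 * u)`, then the skew morphism law at `b`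
becomes `(u - 1) * (u - 1 - 2 * s) ≡ 0` modulo `p`. The factor `u - 1` gives a shift of the odd
powers of `b`, the factor `u - 1 - 2 * s` gives the automorphism `c ↦ c ^ (2 * s + 1)`. -/
theorem exists_eq_oddShift (hp : p.Prime) (hp2 : p ≠ 2) (hG : Nat.card G = 4 * p)
    (hφ : ¬ IsAutomorphism φ) (hK : Nat.card (skewKernel h) = 2 * p) :
    ∃ (s : ℤ) (hs : (2 : ℤ) ∣ s), φ = oddShift b s hs := by
  have hpp : Prime (p : ℤ) := Nat.prime_iff_prime_int.1 hp
  have hpos := hp.pos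
  have hpodd := hp.odd_of_ne_two hp2
  have hcop : IsCoprime (2 : ℤ) p :=
    Nat.isCoprime_iff_coprime.2 (Nat.coprime_two_left.2 hpodd)
  have h1 := Subgroup.card_eq_card_quotient_mul_card_subgroup (skewKernel h)
  have hidx : Nat.card (G ⧸ skewKernel h) = 2 :=
    Nat.eq_of_mul_eq_mul_right (show 0 < 2 * p by omega) (by rw [← hK, ← h1, hG, hK]; ring)
  have hmem : ∀ n : ℤ, b ^ n ∈ skewKernel h ↔ (2 : ℤ) ∣ n := fun n => by
    rw [zpow_mem_iff hb, hidx]; rfl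
  have heq := zpow_eq_zpow_iff_dvd hG hb
  obtain ⟨x, hx⟩ := hb (φ b)
  obtain ⟨y, hy⟩ := hb (φ (b ^ (2 : ℤ)))
  dsimp only at hx hy
  obtain ⟨s, rfl⟩ : ∃ s, x = 2 * s + 1 := by
    have h2 : b ∉ skewKernel h := fun h3 => by
      have := (hmem 1).1 (by rwa [zpow_one])
      omega
    rw [← apply_mem_skewKernel_iff h hb, ← hx, hmem] at h2
    exact ⟨x / 2, by omega⟩
  have hb2 : b ^ (2 : ℤ) ∈ skewKernel h := (hmem 2).2 dvd_rfl
  obtain ⟨u, rfl⟩ : ∃ u, y = 2 * u := by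
    rwa [← apply_mem_skewKernel_iff h hb, ← hy, hmem] at hb2
  have heven : ∀ t : ℤ, φ (b ^ (2 * t)) = b ^ (2 * u * t) := fun t => by
    rw [zpow_mul, apply_zpow_of_mem h hb2, ← hy, ← zpow_mul]
  have hodd : ∀ t : ℤ, φ (b ^ (2 * t + 1)) = b ^ (2 * u * t + (2 * s + 1)) := fun t => by
    rw [zpow_add, ((hmem _).2 (dvd_mul_right 2 t)), heven, zpow_one, ← hx, ← zpow_add]
  -- `φ` is injective on the even powers of `b`
  have hu : (2 : ℤ) ∣ u - 1 := by
    by_contra hu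
    obtain ⟨v, rfl⟩ : (2 : ℤ) ∣ u := by omega
    have h2 : φ (b ^ (2 * p : ℤ)) = φ (b ^ (2 * 0 : ℤ)) := by
      rw [heven, heven, heq]
      exact ⟨v, by ring⟩
    have h3 := (heq _ _).1 (φ.injective h2)
    have h4 := Int.le_of_dvd (by omega) h3
    omega
  have hpe : ∀ j : ℕ, (φ ^ j) (b ^ (2 : ℤ)) = b ^ (2 * u ^ j) := by
    intro j
    induction j with
    | zero => simp
    | succ j ih =>
      rw [pow_succ', Equiv.Perm.mul_apply, ih, heven]
      congr 1; ring
  have hpo : ∀ j : ℕ, (φ ^ j) b = b ^ (2 * (s * ∑ t ∈ Finset.range j, u ^ t) + 1) := by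
    intro j
    induction j with
    | zero => simp
    | succ j ih =>
      rw [pow_succ', Equiv.Perm.mul_apply, ih, hodd, geom_sum_succ]
      congr 1; ring
  obtain ⟨i, -, hi⟩ := h.2 b
  have e1 : (4 * p : ℤ) ∣ 2 * u ^ i - 2 * u := by
    have h2 := hi (b ^ (2 : ℤ))
    rw [apply_mul_of_mem h hb2] at h2
    have h3 := mul_left_cancel h2
    rw [hpe, ← hy, heq] at h3
    exact (dvd_sub_comm).1 h3
  have e2 : (4 * p : ℤ) ∣
      2 * u * 1 - (2 * s + 1 + (2 * (s * ∑ t ∈ Finset.range i, u ^ t) + 1)) := by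
    have h2 := hi b
    rw [hpo, ← hx, ← zpow_add, show b * b = b ^ (2 * 1 : ℤ) by rw [mul_one, zpow_ofNat, sq],
      heven, heq] at h2
    exact h2
  have hgs := geom_sum_mul u i
  have e3 : (p : ℤ) ∣ (u - 1) * (u - 1 - 2 * s) := by
    obtain ⟨q1, hq1⟩ := e1
    obtain ⟨q2, hq2⟩ := e2
    have h2 : 2 * ((u - 1) * (u - 1 - 2 * s)) = 2 * (p * (2 * ((u - 1) * q2 + s * q1))) := by
      linear_combination (u - 1) * hq2 + s * hq1 + 2 * s * hgs
    exact ⟨2 * ((u - 1) * q2 + s * q1), by linarith⟩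
  rcases hpp.dvd_or_dvd e3 with h2 | h2
  · obtain ⟨q, hq⟩ := hcop.mul_dvd hu h2
    refine ⟨2 * s, dvd_mul_right _ _, Equiv.ext fun c => ?_⟩
    obtain ⟨n, rfl⟩ := hb c
    dsimp only
    rcases Int.even_or_odd' n with ⟨t, rfl | rfl⟩
    · rw [heven, oddShift_apply_even hG hb, heq]
      exact ⟨q * t, by linear_combination 2 * t * hq⟩
    · rw [hodd, oddShift_apply_odd hG hb, heq]
      exact ⟨q * t, by linear_combination 2 * t * hq⟩
  · obtain ⟨q, hq⟩ := hcop.mul_dvd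
      (dvd_sub hu (dvd_mul_right 2 s)) h2
    refine absurd (isAutomorphism_iff.2 ?_) hφ
    have hpw : ∀ c, φ c = c ^ (1 + 2 * s) := by
      intro c
      obtain ⟨n, rfl⟩ := hb c
      dsimp only
      rw [← zpow_mul]
      rcases Int.even_or_odd' n with ⟨t, rfl | rfl⟩
      · rw [heven, heq]
        exact ⟨q * t, by linear_combination 2 * t * hq⟩
      · rw [hodd, heq]
        exact ⟨q * t, by linear_combination 2 * t * hq⟩
    intro a c
    rw [hpw, hpw, hpw, mul_zpow]

/-! ### Kernels of prime order -/

/-- On a kernel of prime order a nontrivial power `φ ^ j` is fixed-point-free, so that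
`k ↦ k * (φ ^ j k)⁻¹` is bijective. -/
theorem pow_fixed_point_free (hK : (Nat.card (skewKernel h)).Prime) {j : ℕ} {x : G}
    (hx : x ∈ skewKernel h) (hxj : (φ ^ j) x ≠ x) :
    (∀ k ∈ skewKernel h, (φ ^ j) k = k → k = 1) ∧
      ∀ f ∈ skewKernel h, ∃ k ∈ skewKernel h, f * (φ ^ j) k = k := by
  let F : skewKernel h →* skewKernel h :=
    { toFun := fun k => ⟨k * ((φ ^ j) k)⁻¹, (skewKernel h).mul_mem k.2
        ((skewKernel h).inv_mem (pow_apply_mem_skewKernel h hb k.2 j))⟩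
      map_one' := Subtype.ext (by simp [h.pow_apply_one])
      map_mul' := fun k l => Subtype.ext (by
        simp only [Subgroup.coe_mul, pow_apply_mul_of_mem h hb l.2, mul_inv]
        exact mul_mul_mul_comm _ _ _ _) }
  have hker : F.ker = ⊥ := by
    have : Fact (Nat.card (skewKernel h)).Prime := ⟨hK⟩
    refine (Subgroup.eq_bot_or_eq_top_of_prime_card F.ker).resolve_right fun htop => hxj ?_
    have h1 : (⟨x, hx⟩ : skewKernel h) ∈ F.ker := htop ▸ Subgroup.mem_top _
    have h2 := congrArg Subtype.val (MonoidHom.mem_ker.1 h1)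
    exact (mul_inv_eq_one.1 h2).symm
  have hinj := (MonoidHom.ker_eq_bot_iff F).1 hker
  have hsurj := Finite.injective_iff_surjective.1 hinj
  constructor
  · intro k hk hkj
    have h1 : (⟨k, hk⟩ : skewKernel h) ∈ F.ker :=
      MonoidHom.mem_ker.2 (Subtype.ext (mul_inv_eq_one.2 hkj.symm))
    rw [hker, Subgroup.mem_bot] at h1
    exact congrArg Subtype.val h1
  · intro f hf
    obtain ⟨k, hk⟩ := hsurj ⟨f, hf⟩
    refine ⟨k, k.2, ?_⟩
    have h1 : (k : G) * ((φ ^ j) k)⁻¹ = f := congrArg Subtype.val hk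
    rw [← h1, inv_mul_cancel_right]

/-- A power of `φ` that is nontrivial on a kernel of prime order has a fixed point in every coset
that it preserves. -/
theorem exists_pow_fixed_in_coset (hK : (Nat.card (skewKernel h)).Prime) {j : ℕ} {x : G}
    (hx : x ∈ skewKernel h) (hxj : (φ ^ j) x ≠ x) {c : G} (hc : c⁻¹ * (φ ^ j) c ∈ skewKernel h) :
    ∃ k ∈ skewKernel h, (φ ^ j) (c * k) = c * k := by
  obtain ⟨k, hk, hkk⟩ := (pow_fixed_point_free h hb hK hx hxj).2 _ hc
  refine ⟨k, hk, ?_⟩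
  rw [pow_apply_mul_of_mem h hb hk]
  rwa [mul_assoc, inv_mul_eq_iff_eq_mul] at hkk

theorem inv_mul_pow_apply_mem {j : ℕ} (hj : b⁻¹ * (φ ^ j) b ∈ skewKernel h) (c : G) :
    c⁻¹ * (φ ^ j) c ∈ skewKernel h := by
  have h1 := (isSkewMorphism_quotientPerm h hb).pow_eq_one_of_apply_eq
    (fun x => mk_mem_zpowers hb x) (k := j)
    (by rw [quotientPerm_pow_mk]; exact (QuotientGroup.eq.2 hj).symm)
  rw [← QuotientGroup.eq, ← quotientPerm_pow_mk h hb, h1]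
  rfl

/-- If the kernel has prime order `p` and index `4`, then `φ` preserves its cosets and moves each
of them by a translation. -/
theorem exists_translation_of_card_skewKernel_prime (hK : (Nat.card (skewKernel h)).Prime)
    (hidx : Nat.card (G ⧸ skewKernel h) = 4) (hφ : ¬ IsAutomorphism φ) :
    ∃ g : G → G, (∀ c, g c ∈ skewKernel h) ∧ (∀ c, φ c = c * g c) ∧
      (∀ c, ∀ k ∈ skewKernel h, g (c * k) = g c) ∧
      (∃ κ : ℕ, ∀ c, g (b * c) = g b * g c ^ κ) ∧ g b ≠ 1 := by
  have hmem : ∀ n : ℤ, b ^ n ∈ skewKernel h ↔ (4 : ℤ) ∣ n := fun n => by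
    rw [zpow_mem_iff hb, hidx]; rfl
  have hb2 : b * b ∉ skewKernel h := by
    rw [← sq, ← zpow_ofNat, hmem]; norm_num
  have hq : IsAutomorphism (quotientPerm h hb) :=
    isAutomorphism_of_card_four (isSkewMorphism_quotientPerm h hb) (fun x => mk_mem_zpowers hb x)
      hidx
  have hqm := isAutomorphism_iff.1 hq
  obtain ⟨N, g, hdvd, hgK, hpow, hgk, hκ, hm⟩ := exists_translation_power h hb hq
  have hgb : g b ≠ 1 := fun h1 => hφ (isAutomorphism_of_apply_eq_one h hb hpow hm h1)
  -- a fixed point in the coset of `b` would make `g b` trivial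
  have hfix : ∀ j, j ∣ N → b⁻¹ * (φ ^ j) b ∈ skewKernel h → ∀ k ∈ skewKernel h, (φ ^ j) k = k := by
    intro j hj hjb x hx
    by_contra hxj
    obtain ⟨k, hk, hkk⟩ := exists_pow_fixed_in_coset h hb hK hx hxj hjb
    have h1 : (φ ^ (N * 1)) (b * k) = b * k :=
      (pow_apply_eq_self_iff _ _ _).2 (((pow_apply_eq_self_iff _ _ _).1 hkk).trans
        (hj.trans (dvd_mul_right _ _)))
    rw [hpow, pow_one, hgk b k hk, mul_eq_left] at h1
    exact hgb h1
  have hcase : b⁻¹ * φ b ∈ skewKernel h ∨ b * φ b ∈ skewKernel h := by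
    obtain ⟨x, hx⟩ := hb (φ b)
    dsimp only at hx
    have h1 : ¬ (4 : ℤ) ∣ x + x := by
      rw [← hmem, zpow_add, hx, ← QuotientGroup.eq_one_iff, QuotientGroup.mk_mul,
        ← quotientPerm_mk h hb, ← hqm, ← QuotientGroup.mk_mul, quotientPerm_mk,
        QuotientGroup.eq_one_iff, apply_mem_skewKernel_iff h hb]
      exact hb2
    rw [← hx, ← zpow_neg_one, ← zpow_add, hmem, ← zpow_one_add, hmem]
    omega
  rcases hcase with hb1 | hb1
  · have hN1 : N ∣ 1 := by
      have hb1 : b⁻¹ * (φ ^ 1) b ∈ skewKernel h := by rwa [pow_one]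
      exact (hdvd 1).2 ⟨hfix 1 (one_dvd _) hb1, inv_mul_pow_apply_mem h hb hb1⟩
    obtain rfl := Nat.dvd_one.1 hN1
    exact ⟨g, hgK, fun c => by simpa using hpow 1 c, hgk, hκ b, hgb⟩
  exfalso
  -- `φ` inverts the quotient; comparing the two expansions of `φ (a * c) = φ (c * a)` contradicts
  -- the fact that different cosets have different exponents
  have hQ1 : quotientPerm h hb (b : G ⧸ skewKernel h) = (b : G ⧸ skewKernel h)⁻¹ := by
    rw [quotientPerm_mk, eq_inv_iff_mul_eq_one, mul_comm, ← QuotientGroup.mk_mul,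
      QuotientGroup.eq_one_iff]
    exact hb1
  have hQ2 : b⁻¹ * (φ ^ 2) b ∈ skewKernel h := by
    rw [← QuotientGroup.eq, ← quotientPerm_pow_mk h hb, sq, Equiv.Perm.mul_apply, hQ1]
    obtain ⟨α, hα⟩ := hq
    rw [hα] at hQ1 ⊢
    have h2 := map_inv α (b : G ⧸ skewKernel h)
    have h3 : α (b : G ⧸ skewKernel h) = (b : G ⧸ skewKernel h)⁻¹ := hQ1
    rw [h3, inv_inv] at h2
    exact h2.symm
  have hN2 : 2 ∣ N := by
    by_contra hodd
    obtain ⟨t, ht⟩ : ∃ t, N = 2 * t + 1 := ⟨N / 2, by omega⟩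
    have h1 := (isSkewMorphism_quotientPerm h hb).pow_eq_one_of_apply_eq
      (fun x => mk_mem_zpowers hb x) (k := 2)
      (by rw [quotientPerm_pow_mk]; exact (QuotientGroup.eq.2 hQ2).symm)
    have h2 := QuotientGroup.eq.2 (((hdvd N).1 dvd_rfl).2 b)
    rw [← quotientPerm_pow_mk h hb, ht, pow_succ', pow_mul, h1, one_pow, mul_one, hQ1,
      eq_inv_iff_mul_eq_one, ← QuotientGroup.mk_mul, QuotientGroup.eq_one_iff] at h2
    exact hb2 h2
  choose m hm using hm
  have hsymm : ∀ a c, g c ^ m a = g a ^ m c := by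
    intro a c
    have hgm : ∀ c j, g c ^ j ∈ skewKernel h := fun c j => (skewKernel h).pow_mem (hgK c) j
    have h1 := hm a c
    rw [mul_comm a c, hm c a, apply_mul_of_mem h (hgm _ _), apply_mul_of_mem h (hgm _ _),
      mul_left_comm] at h1
    exact (φ.injective (mul_left_cancel (mul_left_cancel h1))).symm
  have hgφ : ∀ c, g (φ c) = φ (g c) := by
    intro c
    have h1 := hpow 1 (φ c)
    rw [← Equiv.Perm.mul_apply, ← pow_succ, pow_succ', Equiv.Perm.mul_apply, hpow, pow_one,
      pow_one, apply_mul_of_mem h (hgK c)] at h1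
    exact (mul_left_cancel h1).symm
  have horder : orderOf (g b) = Nat.card (skewKernel h) := by
    have h1 : orderOf (g b) ∣ Nat.card (skewKernel h) :=
      orderOf_dvd_of_pow_eq_one
        (congrArg Subtype.val (pow_card_eq_one' (x := (⟨g b, hgK b⟩ : skewKernel h))))
    exact ((Nat.dvd_prime hK).1 h1).resolve_left fun h2 => hgb (orderOf_eq_one_iff.1 h2)
  have hexp : ∀ i j c, g b ^ i = g b ^ j → g c ^ i = g c ^ j := by
    intro i j c hij
    rw [pow_eq_pow_iff_modEq, horder] at hij
    rw [pow_eq_pow_iff_modEq]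
    exact hij.of_dvd (orderOf_dvd_of_pow_eq_one
        (congrArg Subtype.val (pow_card_eq_one' (x := (⟨g c, hgK c⟩ : skewKernel h)))))
  by_cases htriv : ∃ x ∈ skewKernel h, φ x ≠ x
  · obtain ⟨x, hx, hxx⟩ := htriv
    have h1 : φ (g (b * b)) = g (b * b) := by
      rw [← hgφ]
      have h2 : (b * b)⁻¹ * φ (b * b) ∈ skewKernel h := by
        rw [← QuotientGroup.eq, ← quotientPerm_mk h hb, QuotientGroup.mk_mul, hqm, hQ1,
          ← mul_inv, eq_inv_iff_mul_eq_one, ← QuotientGroup.mk_mul, ← QuotientGroup.mk_mul,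
          QuotientGroup.eq_one_iff, show b * b * (b * b) = b ^ (4 : ℤ) by
            rw [zpow_ofNat]; simp only [pow_succ, pow_zero, one_mul, mul_assoc], hmem]
      have h3 := hgk (b * b) _ h2
      rwa [mul_inv_cancel_left] at h3
    have h2 : g (b * b) = 1 :=
      (pow_fixed_point_free h hb hK hx (j := 1) hxx).1 _ (hgK _) h1
    have h3 := hsymm (b * b) b
    rw [h2, one_pow, ← pow_zero (g b)] at h3
    refine hb2 fun c => ?_
    rw [hm, hexp _ _ c h3, pow_zero, mul_one]
  · push Not at htriv
    have h1 : g b⁻¹ = g b := by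
      have h2 := hgk b⁻¹ _ hb1
      rw [inv_mul_cancel_left, hgφ, htriv _ (hgK b)] at h2
      exact h2.symm
    have h2 := hsymm b⁻¹ b
    rw [h1] at h2
    refine hb2 ?_
    have h3 := inv_mul_mem_skewKernel h (a := b⁻¹) (a' := b) (fun c => φ (c * g c ^ m b)) ?_
      (hm b)
    · rwa [inv_inv] at h3
    · intro c
      rw [hm, hexp _ _ c h2]

/-- With translations given by `g b = b ^ (4 * i)` and exponent `κ` at `b`, closing up after four
steps means `(1 + κ) * (1 + κ ^ 2) ≡ 0` modulo `p`. -/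
theorem isY_or_isZ (hp : p.Prime) (hp2 : p ≠ 2) (hG : Nat.card G = 4 * p)
    (hφ : ¬ IsAutomorphism φ) (hK : Nat.card (skewKernel h) = p) :
    IsY p b φ ∨ (p ≡ 1 [MOD 4] ∧ IsZ p b φ) := by
  have hpp : Prime (p : ℤ) := Nat.prime_iff_prime_int.1 hp
  have hpos := hp.pos
  have h1 := Subgroup.card_eq_card_quotient_mul_card_subgroup (skewKernel h)
  have hidx : Nat.card (G ⧸ skewKernel h) = 4 :=
    Nat.eq_of_mul_eq_mul_right hpos (by rw [← hG, h1, hK])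
  have hmem : ∀ n : ℤ, b ^ n ∈ skewKernel h ↔ (4 : ℤ) ∣ n := fun n => by
    rw [zpow_mem_iff hb, hidx]; rfl
  have heq := zpow_eq_zpow_iff_dvd hG hb
  obtain ⟨g, hgK, hφg, hgk, ⟨κ, hκ⟩, hgb⟩ :=
    exists_translation_of_card_skewKernel_prime h hb (hK.symm ▸ hp) hidx hφ
  have hg1 : g 1 = 1 := by
    have h2 := hφg 1
    rwa [h.1, one_mul, eq_comm] at h2
  obtain ⟨i, hi1, hip, hi⟩ : ∃ i : ℕ, 1 ≤ i ∧ i ≤ p - 1 ∧ g b = b ^ (4 * i : ℤ) := by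
    obtain ⟨n, hn⟩ := hb (g b)
    dsimp only at hn
    obtain ⟨t, rfl⟩ := (hmem n).1 (hn ▸ hgK b)
    have h2 := Int.emod_nonneg t (show (p : ℤ) ≠ 0 by omega)
    have h3 := Int.emod_lt_of_pos t (show (0 : ℤ) < p by omega)
    have h4 := Int.mul_ediv_add_emod t p
    have h5 : ((t % p).toNat : ℤ) = t % p := Int.toNat_of_nonneg h2
    have h6 : g b = b ^ (4 * ((t % p).toNat : ℤ)) := by
      rw [← hn, heq, h5]
      exact ⟨t / p, by linear_combination -4 * h4⟩
    refine ⟨(t % p).toNat, ?_, by omega, h6⟩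
    by_contra h7
    rw [show (t % p).toNat = 0 by omega] at h6
    exact hgb (by simpa using h6)
  have hpi : ¬ (p : ℤ) ∣ i := fun h2 => by
    have := Nat.le_of_dvd hi1 (Int.natCast_dvd_natCast.1 h2)
    omega
  have hgpow : ∀ n : ℕ, g (b ^ n) = b ^ (4 * i * ∑ t ∈ Finset.range n, (κ : ℤ) ^ t) := by
    intro n
    rw [apply_pow_generator hg1 hκ, hi, ← zpow_natCast, ← zpow_mul]
    push_cast
    rfl
  have hval : ∀ (t : ℤ) (n : ℕ),
      φ (b ^ (4 * t + n)) = b ^ (4 * t + n + 4 * i * ∑ t ∈ Finset.range n, (κ : ℤ) ^ t) := by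
    intro t n
    rw [hφg, zpow_add, mul_comm (b ^ (4 * t)), hgk _ _ ((hmem _).2 (dvd_mul_right _ _)),
      zpow_natCast, hgpow, zpow_add, zpow_add, zpow_natCast, mul_comm (b ^ (4 * t))]
  have hclose : (p : ℤ) ∣ (1 + κ) * (1 + κ ^ 2) := by
    have h2 := hgpow 4
    have h3 : b ^ 4 ∈ skewKernel h := by
      rw [← zpow_natCast, hmem]; norm_num
    rw [← one_mul (b ^ 4), hgk _ _ h3, hg1, ← zpow_zero b, heq] at h2
    obtain ⟨q, hq⟩ := h2
    simp only [Finset.sum_range_succ, Finset.sum_range_zero] at hq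
    have h4 : (p : ℤ) ∣ i * ((1 + κ) * (1 + κ ^ 2)) := ⟨-q, by linarith⟩
    exact (hpp.dvd_or_dvd h4).resolve_left hpi
  have hcases : ∀ n : ℤ, ∃ t, n = 4 * t + (0 : ℕ) ∨ n = 4 * t + (1 : ℕ) ∨ n = 4 * t + (2 : ℕ) ∨
      n = 4 * t + (3 : ℕ) := fun n => ⟨n / 4, by push_cast; omega⟩
  rcases hpp.dvd_or_dvd hclose with ⟨q, hq⟩ | ⟨q, hq⟩
  · left
    refine ⟨i, hi1, hip, Equiv.ext fun c => ?_⟩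
    obtain ⟨n, rfl⟩ := hb c
    dsimp only
    obtain ⟨t, rfl | rfl | rfl | rfl⟩ := hcases n <;> rw [hval]
    · rw [show 4 * t + ((0 : ℕ) : ℤ) = 2 * (2 * t) by push_cast; ring, (yPerm_apply hG hb _ _).2]
      simp
    · rw [show 4 * t + ((1 : ℕ) : ℤ) = 2 * (2 * t) + 1 by push_cast; ring,
        (yPerm_apply hG hb _ _).1]
      simp
    · rw [show 4 * t + ((2 : ℕ) : ℤ) = 2 * (2 * t + 1) by push_cast; ring,
        (yPerm_apply hG hb _ _).2, heq]
      refine ⟨i * q, ?_⟩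
      simp only [Finset.sum_range_succ, Finset.sum_range_zero]
      linear_combination 4 * i * hq
    · rw [show 4 * t + ((3 : ℕ) : ℤ) = 2 * (2 * t + 1) + 1 by push_cast; ring,
        (yPerm_apply hG hb _ _).1, heq]
      refine ⟨i * κ * q, ?_⟩
      simp only [Finset.sum_range_succ, Finset.sum_range_zero]
      linear_combination 4 * i * κ * hq
  · right
    have hω : (κ : ℤ) ^ 2 ≡ -1 [ZMOD p] :=
      (Int.modEq_iff_dvd.2 ⟨q, by linear_combination hq⟩).symm
    constructor
    · have : Fact p.Prime := ⟨hp⟩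
      have h2 : IsSquare (-1 : ZMod p) := by
        have h3 := (ZMod.intCast_eq_intCast_iff _ _ _).2 hω
        push_cast at h3
        exact ⟨κ, by rw [← h3, sq]⟩
      have h3 := ZMod.exists_sq_eq_neg_one_iff.1 h2
      have h4 := hp.eq_two_or_odd
      show p % 4 = 1 % 4
      omega
    · refine ⟨κ, i, hω, hi1, hip, Equiv.ext fun c => ?_⟩
      obtain ⟨n, rfl⟩ := hb c
      dsimp only
      obtain ⟨t, ht⟩ := hcases n
      obtain ⟨z1, z2, z3, z0⟩ := zPerm_apply hG hb κ i t
      rcases ht with rfl | rfl | rfl | rfl <;> rw [hval]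
      · simpa using z0.symm
      · simpa using z1.symm
      · push_cast
        rw [z2]
        simp [Finset.sum_range_succ, add_comm]
      · push_cast
        rw [z3, heq]
        refine ⟨i * q, ?_⟩
        simp only [Finset.sum_range_succ, Finset.sum_range_zero]
        linear_combination 4 * i * hq

end Classification

/-! ### The classification -/

section Converse

variable {G : Type*} [Group G] {p : ℕ} {b : G} {φ : Equiv.Perm G}

theorem IsX.isProperSkewMorphism (hp : p.Prime) (hG : Nat.card G = 4 * p)
    (hb : ∀ g : G, g ∈ Subgroup.zpowers b) (h : IsX p b φ) : IsProperSkewMorphism φ := by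
  obtain ⟨i, hi, hne, rfl⟩ := h
  have hpos := hp.pos
  refine ⟨isSkewMorphism_oddShift hpos hG hb _, fun h1 => hne ?_⟩
  obtain ⟨q, hq⟩ := (isAutomorphism_oddShift_iff hG hb _).1 h1
  have h2 : 2 * (i : ℤ) + 1 = p * q := by linarith
  have h3 : 0 < q := by
    by_contra h4
    have := mul_nonpos_of_nonneg_of_nonpos (show (0 : ℤ) ≤ p by omega) (not_lt.1 h4)
    omega
  have h4 : q < 2 := by
    by_contra h5
    have := mul_le_mul_of_nonneg_left (not_lt.1 h5) (show (0 : ℤ) ≤ p by omega)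
    omega
  obtain rfl : q = 1 := by omega
  omega

theorem IsY.isProperSkewMorphism (hp : p.Prime) (hp2 : p ≠ 2) (hG : Nat.card G = 4 * p)
    (hb : ∀ g : G, g ∈ Subgroup.zpowers b) (h : IsY p b φ) : IsProperSkewMorphism φ := by
  obtain ⟨i, hi1, hi, rfl⟩ := h
  refine ⟨isSkewMorphism_oddShift hp.pos hG hb _, fun h1 => ?_⟩
  obtain ⟨q, hq⟩ := (isAutomorphism_oddShift_iff hG hb _).1 h1
  have h2 : p ∣ 2 * i := by
    have : (p : ℤ) ∣ ((2 * i : ℕ) : ℤ) := ⟨q, by push_cast; linarith⟩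
    exact Int.natCast_dvd_natCast.1 this
  rcases (Nat.Prime.dvd_mul hp).1 h2 with h3 | h3
  · exact hp2 ((Nat.prime_dvd_prime_iff_eq hp Nat.prime_two).1 h3)
  · have := Nat.le_of_dvd hi1 h3
    omega

theorem IsZ.isProperSkewMorphism (hp : p.Prime) (hp2 : p ≠ 2) (hG : Nat.card G = 4 * p)
    (hb : ∀ g : G, g ∈ Subgroup.zpowers b) (h : IsZ p b φ) : IsProperSkewMorphism φ := by
  obtain ⟨ω, i, hω, hi1, hi, rfl⟩ := h
  refine ⟨isSkewMorphism_zPerm hp.pos hG hb hω i,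
    not_isAutomorphism_zPerm hp hp2 hG hb hω fun h1 => ?_⟩
  have := Nat.le_of_dvd hi1 (Int.natCast_dvd_natCast.1 h1)
  omega

end Converse

theorem isProperSkewMorphism_iff {G : Type*} [CommGroup G] {p : ℕ} (hp : p.Prime) (hp2 : p ≠ 2)
    (hG : Nat.card G = 4 * p) {b : G} (hb : ∀ g : G, g ∈ Subgroup.zpowers b)
    (φ : Equiv.Perm G) :
    IsProperSkewMorphism φ ↔ IsX p b φ ∨ IsY p b φ ∨ (p ≡ 1 [MOD 4] ∧ IsZ p b φ) := by
  have hpos := hp.pos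
  have : Finite G := Nat.finite_of_card_ne_zero (by omega)
  constructor
  · rintro ⟨h, hφ⟩
    rcases card_skewKernel_eq h hb hp hp2 hG hφ with hK | hK
    · exact Or.inr (isY_or_isZ h hb hp hp2 hG hφ hK)
    · obtain ⟨s, hs, rfl⟩ := exists_eq_oddShift h hb hp hp2 hG hφ hK
      exact (isX_or_isY_oddShift hp hp2 hG hb hs hφ).imp_right Or.inl
  · rintro (h | h | ⟨-, h⟩)
    · exact h.isProperSkewMorphism hp hG hb
    · exact h.isProperSkewMorphism hp hp2 hG hb
    · exact h.isProperSkewMorphism hp hp2 hG hb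

end SkewC4p

theorem theorem6p3 {G : Type*} [Group G] (p : ℕ) (hp : p.Prime) (hp2 : p ≠ 2)
    (hG : Nat.card G = 4 * p) (b : G) (hb : ∀ g : G, g ∈ Subgroup.zpowers b)
    (φ : Equiv.Perm G) :
    (SkewC4p.IsProperSkewMorphism φ ↔
      SkewC4p.IsX p b φ ∨ SkewC4p.IsY p b φ ∨ (p ≡ 1 [MOD 4] ∧ SkewC4p.IsZ p b φ)) ∧
    (SkewC4p.IsSkewMorphism φ ↔
      SkewC4p.IsAutomorphism φ ∨
        SkewC4p.IsX p b φ ∨ SkewC4p.IsY p b φ ∨ (p ≡ 1 [MOD 4] ∧ SkewC4p.IsZ p b φ)) := by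
  have : IsCyclic G := ⟨⟨b, hb⟩⟩
  let _ : CommGroup G := IsCyclic.commGroup
  have key := SkewC4p.isProperSkewMorphism_iff hp hp2 hG hb φ
  refine ⟨key, ?_⟩
  rw [← key]
  constructor
  · intro h
    by_cases hφ : SkewC4p.IsAutomorphism φ
    · exact Or.inl hφ
    · exact Or.inr ⟨h, hφ⟩
  · rintro (h | h)
    · exact h.isSkewMorphism
    · exact h.1
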